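/- **Setting.** Let the finite population $\mathcal X=\mathcal X_l\sqcup\mathcal X_u$, with $|\mathcal X_l|=N_l\ge1$, $|\mathcal X_u|=N_u\ge 1$, $N=N_l+N_u$, consist of labeled points (known classes $\mathcal Y_l$, a finite set) and unlabeled points (novel classes). Given probability distributions $\mathcal P_u$, $\mathcal P_{l_i}$ ($i\in\mathcal Y_l$) and $\mathcal T(\cdot\,|\,\bar x)$ ($\bar x\in\mathcal X$) on $\mathcal X$ and $\alpha,\beta\ge 0$, put $$w_{xx'}=\alpha\sum_{i\in\mathcal Y_l}\mathbb E_{a\sim\mathcal P_{l_i}}\mathbb E_{b\sim\mathcal P_{l_i}}\mathcal T(x|a)\mathcal T(x'|b)+\beta\,\mathbb E_{a\sim\mathcal P_u}\mathcal T(x|a)\mathcal T(x'|a),\qquad w_x=\sum_{x'}w_{xx'},$$ and assume $w_x>0$ for all $x$. Let $\dot A_{xx'}=w_{xx'}/\sqrt{w_xw_{x'}}$, with blocks $A_{ll},A_{ul},A_{uu}$, and let $\bar A$ arise from $\dot A$ by averaging over the labeled points: its labeled–labeled entries are the mean $\eta_l$ of the entries of $A_{ll}$, its entry at $(x,x_l)$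 and $(x_l,x)$ with $x\in\mathcal X_u$, $x_l\in\mathcal X_l$, is the mean $(\vec\eta_u)_x$ of row $x$ of $A_{ul}$, and its unlabeled block is $A_{uu}$. Let $\sigma_1\ge\dots\ge\sigma_N$ and $\bar\sigma_1\ge\dots\ge\bar\sigma_N$ be the eigenvalues of $\dot A$ and $\bar A$ (all these matrices are positive semidefinite, so these are their singular values), and let $\bar v_1,\dots,\bar v_N$ be any orthonormal eigenbasis of $\bar A$ belonging to $\bar\sigma_1,\dots,\bar\sigma_N$. Let $1\le k<N$, let $\bar V^\flat=[\bar v_{k+1},\dots,\bar v_N]$, with labeled rows $\bar L^\flat$ and unlabeled rows $\bar U^\flat$, put $\bar{\mathfrak l}^\flat=\bar L^{\flat\top}\mathbf 1$, and for $\vec y\in\mathbb R^{N_u}$ let $$\mathfrak T(\vec y)=\frac{\|\bar U^{\flat\top}\vec y\|_2}{\|\vec y\|_2},\qquad \kappa(\vec y)=\cos(\bar U^{\flat\top}\vec y,\bar{\mathfrak l}^\flat)$$ (a quotient with denominator $0$, here and in the cosine, is read as $0$). **(1) Error bound.** Let $f:\mathcal X\to\mathbb R^k$ minimize the spectral contrastive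 loss $-2\alpha\mathcal L_1-2\beta\mathcal L_2+\alpha^2\mathcal L_3+2\alpha\beta\mathcal L_4+\beta^2\mathcal L_5$, where $$\mathcal L_1=\sum_i\mathbb E_{a,b\sim\mathcal P_{l_i},\,x\sim\mathcal T(\cdot|a),\,x'\sim\mathcal T(\cdot|b)}f(x)^\top f(x'),\qquad \mathcal L_2=\mathbb E_{a\sim\mathcal P_u,\,x,x'\sim\mathcal T(\cdot|a)}f(x)^\top f(x'),$$ and $\mathcal L_3,\mathcal L_4,\mathcal L_5$ are the expectations of $(f(x)^\top f(x'))^2$ for $x\sim\mathcal T(\cdot|a)$, $x'\sim\mathcal T(\cdot|b)$ with independent $a,b$, where $(a,b)\sim\mathcal P_{l_i}\times\mathcal P_{l_j}$ summed over $i,j\in\mathcal Y_l$ for $\mathcal L_3$, $(a,b)\sim\mathcal P_{l_i}\times\mathcal P_u$ summed over $i\in\mathcal Y_l$ for $\mathcal L_4$, and $(a,b)\sim\mathcal P_u\times\mathcal P_u$ for $\mathcal L_5$ (all draws being independent given their parents). Let the points of $\mathcal X_u$ carry labels $y(x)$ in $\mathcal Y_u$, each class having $N_u/|\mathcal Y_u|$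 points, with 0/1 labeling vectors $\vec y_i$, and let $$\mathcal E(f)=\min_{M\in\mathbb R^{k\times|\mathcal Y_u|}}\#\{x\in\mathcal X_u: y(x)\neq \operatorname{argmax}_i (f(x)^\top M)_i\},$$ with any fixed tie-breaking rule. If $\|\dot A-\bar A\|_2<\frac12(\sigma_k-\sigma_{k+1})$, then $$\mathcal E(f)\le\frac{2N_u}{|\mathcal Y_u|}\Bigl(\sum_{i}\mathfrak T(\vec y_i)\bigl(1-\kappa(\vec y_i)^2\bigr)+C\,\frac{\|\dot A-\bar A\|_2}{\sigma_k-\sigma_{k+1}}\Bigr),\qquad C=2\sum_{i}\Bigl(1+\frac{N_l\,\kappa(\vec y_i)^2\,\mathfrak T(\vec y_i)^2}{\|\bar{\mathfrak l}^\flat\|_2^2}\Bigr).$$ **(2) Coverage bound.** Suppose $k\le N_u$. Let $d_1\ge\dots\ge d_{N_u}$ be the eigenvalues of $A_{uu}$ with orthonormal eigenvectors $q_1,\dots,q_{N_u}$, and let $\vec y\in\mathbb R^{N_u}$. Suppose that $\vec\eta_u^\top q_i\ne0$ for all $i\ge k$, that $|d_i-d_j|\ge g>0$ for all $i\ge k$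 and $j\neq i$, and that the numbers $\omega_i=\vec y^\top(\bar\sigma_iI-A_{uu})^\dagger\vec\eta_u$, for $i>k$ with $(\bar{\mathfrak l}^\flat)_i\neq0$, all have the same strict sign $s\in\{1,-1\}$. Put $r_i=\dfrac{\vec y^\top q_i}{\vec\eta_u^\top q_i}$. Then $$s\,\kappa(\vec y)\ \ge\ (1-2\varepsilon)\min_{i,j\ge k}\frac{2\sqrt{r_ir_j}}{|r_i+r_j|},\qquad \varepsilon=\frac{d_k}{N_l\eta_l}+\frac{\|\vec\eta_u\|_2^2}{\eta_l\,g}+\frac{\|\vec y\|_2\|\vec\eta_u\|_2}{\eta_l\,g\,\min_{i\ge k}|r_i|},$$ where the square root of a negative number and a quotient with denominator $0$ are read as $0$. -/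

import Mathlib

open scoped Matrix

namespace NCD

/-- Expectation of `g` under a probability vector `p` on a finite set. -/
noncomputable def expect {S : Type*} [Fintype S] (p : stdSimplex ℝ S) (g : S → ℝ) : ℝ :=
  ∑ a, p.1 a * g a

/-- The data of novel class discovery. The population space is `Xl ⊕ Xu` (labeled points of known
classes, unlabeled points of novel classes) and `Yl` is the set of known classes. `Pu` is the
distribution of natural unlabeled samples, `Pl i` the one of natural labeled samples of class `i`,
and `T xbar` is the distribution of the augmentations of the natural sample `xbar`. -/
structure Data (Xl Xu Yl : Type*) [Fintype Xl] [Fintype Xu] where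
  α : ℝ
  β : ℝ
  α_nonneg : 0 ≤ α
  β_nonneg : 0 ≤ β
  Pu : stdSimplex ℝ (Xl ⊕ Xu)
  Pl : Yl → stdSimplex ℝ (Xl ⊕ Xu)
  T : Xl ⊕ Xu → stdSimplex ℝ (Xl ⊕ Xu)

section Graph

variable {Xl Xu Yl : Type*} [Fintype Xl] [Fintype Xu] [Fintype Yl] (D : Data Xl Xu Yl)

/-- The adjacency matrix `A`, whose entry at `(x, x')` is the edge weight
`α ∑ᵢ 𝔼_{a ∼ Pl i} 𝔼_{b ∼ Pl i} T(x|a) T(x'|b) + β 𝔼_{a ∼ Pu} T(x|a) T(x'|a)`. -/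
noncomputable def Data.adj : Matrix (Xl ⊕ Xu) (Xl ⊕ Xu) ℝ :=
  Matrix.of fun x x' =>
    D.α * ∑ i, expect (D.Pl i) (fun a => expect (D.Pl i) fun b => (D.T a).1 x * (D.T b).1 x')
      + D.β * expect D.Pu (fun a => (D.T a).1 x * (D.T a).1 x')

/-- The total weight `w_x` of the edges at `x`. -/
noncomputable def Data.deg (x : Xl ⊕ Xu) : ℝ := ∑ x', D.adj x x'

/-- The normalized adjacency matrix `D^{-1/2} A D^{-1/2}`. -/
noncomputable def Data.normAdj : Matrix (Xl ⊕ Xu) (Xl ⊕ Xu) ℝ :=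
  Matrix.of fun x x' => D.adj x x' / (√(D.deg x) * √(D.deg x'))

/-- The block `A_uu` of the normalized adjacency matrix. -/
noncomputable def Data.Auu : Matrix Xu Xu ℝ := D.normAdj.toBlocks₂₂

/-- The average `η_l` of the labeled-labeled block of the normalized adjacency matrix. -/
noncomputable def Data.etaL : ℝ :=
  (∑ a : Xl, ∑ b : Xl, D.normAdj (Sum.inl a) (Sum.inl b)) / (Fintype.card Xl : ℝ) ^ 2

/-- The vector `η_u` of the row averages of the unlabeled-labeled block `A_ul`. -/
noncomputable def Data.etaU (x : Xu) : ℝ :=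
  (∑ a : Xl, D.normAdj (Sum.inr x) (Sum.inl a)) / (Fintype.card Xl : ℝ)

/-- The approximation of the normalized adjacency matrix obtained by averaging its rows and columns
over the labeled points. -/
noncomputable def Data.avgAdj : Matrix (Xl ⊕ Xu) (Xl ⊕ Xu) ℝ :=
  Matrix.fromBlocks
    (Matrix.of fun _ _ => D.etaL)
    (Matrix.of fun _ x => (∑ a : Xl, D.normAdj (Sum.inl a) (Sum.inr x)) / (Fintype.card Xl : ℝ))
    (Matrix.of fun x _ => D.etaU x)
    D.Auu

section Loss

variable {k : ℕ} (f : Xl ⊕ Xu → Fin k → ℝ)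

noncomputable def Data.loss1 : ℝ :=
  ∑ i, expect (D.Pl i) fun a => expect (D.Pl i) fun b =>
    expect (D.T a) fun x => expect (D.T b) fun x' => f x ⬝ᵥ f x'

noncomputable def Data.loss2 : ℝ :=
  expect D.Pu fun a => expect (D.T a) fun x => expect (D.T a) fun x' => f x ⬝ᵥ f x'

noncomputable def Data.loss3 : ℝ :=
  ∑ i, ∑ j, expect (D.Pl i) fun a => expect (D.Pl j) fun b =>
    expect (D.T a) fun x => expect (D.T b) fun x' => (f x ⬝ᵥ f x') ^ 2

noncomputable def Data.loss4 : ℝ :=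
  ∑ i, expect (D.Pl i) fun a => expect D.Pu fun b =>
    expect (D.T a) fun x => expect (D.T b) fun x' => (f x ⬝ᵥ f x') ^ 2

noncomputable def Data.loss5 : ℝ :=
  expect D.Pu fun a => expect D.Pu fun b =>
    expect (D.T a) fun x => expect (D.T b) fun x' => (f x ⬝ᵥ f x') ^ 2

/-- The NCD spectral contrastive loss of a feature map `f`. -/
noncomputable def Data.nscl : ℝ :=
  -2 * D.α * D.loss1 f - 2 * D.β * D.loss2 f
    + D.α ^ 2 * D.loss3 f + 2 * D.α * D.β * D.loss4 f + D.β ^ 2 * D.loss5 f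

end Loss

end Graph

/-- The linear probing error: the least number of unlabeled points `x` that are misclassified by
`h(x) = argmaxᵢ (f(x)ᵀ M)ᵢ`, over all `M`. The map `argmax` picks a maximal coordinate. -/
noncomputable def probingError {Xl Xu : Type*} [Fintype Xu] {k c : ℕ}
    (argmax : (Fin c → ℝ) → Fin c) (label : Xu → Fin c) (f : Xl ⊕ Xu → Fin k → ℝ) : ℕ :=
  ⨅ M : Matrix (Fin k) (Fin c) ℝ,
    (Finset.univ.filter fun x : Xu => label x ≠ argmax (f (Sum.inr x) ᵥ* M)).card

/-- The 0/1 labeling vector of class `i` (the `i`-th column of the one-hot label matrix). -/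
def labelVec {Xu : Type*} {c : ℕ} (label : Xu → Fin c) (i : Fin c) : Xu → ℝ :=
  fun x => if label x = i then 1 else 0

/-- `σ` lists the eigenvalues of the symmetric matrix `A` in decreasing order (with multiplicity)
and the columns of `V` form a corresponding orthonormal basis of eigenvectors. For positive
semidefinite `A`, which all the matrices considered here are, these are the singular values and
singular vectors. -/
def IsSpectral {n : Type*} [Fintype n] {N : ℕ} (A : Matrix n n ℝ) (σ : Fin N → ℝ)
    (V : Matrix n (Fin N) ℝ) : Prop :=
  Fintype.card n = N ∧ Antitone σ ∧ Vᵀ * V = 1 ∧ A * V = V * Matrix.diagonal σ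

/-- The spectral (operator) norm. -/
noncomputable def specNorm {n : Type*} [Fintype n] [DecidableEq n] (A : Matrix n n ℝ) : ℝ :=
  ‖Matrix.toEuclideanCLM (n := n) (𝕜 := ℝ) A‖

/-- The Euclidean norm. -/
noncomputable def norm2 {n : Type*} [Fintype n] (v : n → ℝ) : ℝ := √(v ⬝ᵥ v)

/-- The cosine of the angle between two vectors (`0` if one of them vanishes). -/
noncomputable def cosine {n : Type*} [Fintype n] (u v : n → ℝ) : ℝ :=
  (u ⬝ᵥ v) / (norm2 u * norm2 v)

section Tail

variable {Xl Xu : Type*} [Fintype Xl] [Fintype Xu] {N : ℕ} (k : ℕ)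
  (V : Matrix (Xl ⊕ Xu) (Fin N) ℝ)

/-- The unlabeled rows of the columns `k + 1, …, N` of `V` (positions are counted from `0`). -/
def Uflat : Matrix Xu {i : Fin N // k ≤ (i : ℕ)} ℝ := Matrix.of fun x i => V (Sum.inr x) i.1

/-- The labeled rows of the columns `k + 1, …, N` of `V`. -/
def Lflat : Matrix Xl {i : Fin N // k ≤ (i : ℕ)} ℝ := Matrix.of fun x i => V (Sum.inl x) i.1

/-- The vector `(L^♭)ᵀ 1`. -/
def lflat : {i : Fin N // k ≤ (i : ℕ)} → ℝ := (Lflat k V)ᵀ *ᵥ fun _ => 1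

/-- The ignorance degree `𝔗(y) = ‖(U^♭)ᵀ y‖ / ‖y‖`. -/
noncomputable def ignorance (y : Xu → ℝ) : ℝ := norm2 ((Uflat k V)ᵀ *ᵥ y) / norm2 y

/-- The coverage `κ(y) = cos((U^♭)ᵀ y, 𝔩^♭)`. -/
noncomputable def coverage (y : Xu → ℝ) : ℝ := cosine ((Uflat k V)ᵀ *ᵥ y) (lflat k V)

end Tail

section EigenRatios

variable {Xu : Type*} [Fintype Xu] {Nu : ℕ}

/-- `yᵀ q_j`, where `q_j` is the `j`-th column of `Q`. -/
def coord (Q : Matrix Xu (Fin Nu) ℝ) (y : Xu → ℝ) (j : Fin Nu) : ℝ := y ⬝ᵥ fun x => Q x j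

/-- `yᵀ (s I - A)^† η` for the symmetric matrix `A` with eigenvalues `d` and orthonormal
eigenvectors `Q`. Since `0⁻¹ = 0`, this is the Moore–Penrose inverse. -/
noncomputable def omega (d : Fin Nu → ℝ) (Q : Matrix Xu (Fin Nu) ℝ) (y η : Xu → ℝ) (s : ℝ) : ℝ :=
  y ⬝ᵥ ((Q * Matrix.diagonal (fun j => (s - d j)⁻¹) * Qᵀ) *ᵥ η)

/-- The ratio `yᵀ q_j / ηᵀ q_j`. -/
noncomputable def ratio (Q : Matrix Xu (Fin Nu) ℝ) (y η : Xu → ℝ) (j : Fin Nu) : ℝ :=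
  coord Q y j / coord Q η j

end EigenRatios

end NCD

/-! Error bound. Up to a constant the loss is `‖Ȧ - F Fᵀ‖²` in Frobenius norm, where `F` has the
rows `√w_x f(x)` (`Data.nscl_eq`). With an eigengap at `k`, the column space of an optimal `F`
contains the top `k` eigenvectors of `Ȧ` (`IsSpectral.top_mem_range_of_minimizer`), so linear
functions of the features fit any vector `w` up to its component in the low eigenspaces. Only
unlabeled points are scored, hence `w` may be chosen freely on the labeled ones: take `w = y` on
unlabeled points and the constant `-t` on labeled points. `IsSpectral.davisKahan` replaces the low
spectral projection of `Ȧ` by that of `Ā` at the cost `2 ‖Ȧ - Ā‖ ‖w‖² / (σ_k - σ_{k+1})`. For `Ā`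
the residual is `‖(U^♭)ᵀ y - t 𝔩^♭‖²`; the best `t` removes the component along `𝔩^♭`, which leaves
the factor `1 - κ²`, while the summand `N_l t²` of `‖w‖²` produces the second term of `C`. A
misclassified point has squared regression error at least `1/2`, and the positive factors `√w_x` do
not affect the argmax (`probingError_le`).

Coverage bound. Let an eigenvector of `Ā` have eigenvalue `x` and labeled sum `l ≠ 0`, and let
`e_j`, `c_j` be the coordinates of `η_u` and `y` in the eigenbasis of `A_uu`. Its unlabeled
coordinates are `l e_j / (x - d_j)`, so its pairing with `y` is `l ω`, and `x` solves `∑ e_j² / (d_j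
- x) = η_l - x / N_l` (`Data.secular`). Thus `κ` compares the numbers `ω_i` with a constant under
the weights `l_i²`, and a reverse Cauchy-Schwarz inequality bounds it by the spread of the `ω_i`
(`sign_mul_cosine_ge`). When `η_l` is large, the secular equation forces `x` to lie just below a
pole `d_m` whose term is nearly `η_l`; the matching term of `-ω = ∑ c_j e_j / (d_j - x)` is then
nearly `r_m η_l` and dominates (`secular_estimate`). The interlacing `Data.sigma_le` ensures that
only poles of index at least `k` occur. -/

namespace NCD

/-! ### Perturbation of eigenvalues and spectral projections. -/

section Spectral

variable {n : Type*} [Fintype n]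

theorem norm2_nonneg (v : n → ℝ) : 0 ≤ norm2 v := Real.sqrt_nonneg _

theorem dotProduct_self_nonneg' (v : n → ℝ) : 0 ≤ v ⬝ᵥ v :=
  Finset.sum_nonneg fun i _ => mul_self_nonneg (v i)

theorem norm2_sq (v : n → ℝ) : norm2 v ^ 2 = v ⬝ᵥ v := Real.sq_sqrt (dotProduct_self_nonneg' v)

theorem norm2_pos {v : n → ℝ} (hv : v ≠ 0) : 0 < norm2 v := by
  refine Real.sqrt_pos.2 (lt_of_le_of_ne (dotProduct_self_nonneg' v) ?_)
  exact fun h => hv (dotProduct_self_eq_zero.1 h.symm)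

theorem abs_dotProduct_le (u v : n → ℝ) : |u ⬝ᵥ v| ≤ norm2 u * norm2 v := by
  refine abs_le_of_sq_le_sq ?_ (mul_nonneg (norm2_nonneg u) (norm2_nonneg v))
  rw [mul_pow, norm2_sq, norm2_sq]
  simpa [dotProduct, sq] using Finset.sum_mul_sq_le_sq_mul_sq Finset.univ u v

theorem norm2_eq_norm (v : n → ℝ) : norm2 v = ‖WithLp.toLp 2 v‖ := by
  rw [EuclideanSpace.norm_eq, norm2]
  simp [dotProduct, sq]

theorem specNorm_nonneg [DecidableEq n] (M : Matrix n n ℝ) : 0 ≤ specNorm M := norm_nonneg _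

theorem dotProduct_mulVec_le_specNorm [DecidableEq n] (M : Matrix n n ℝ) (u v : n → ℝ) :
    |u ⬝ᵥ M *ᵥ v| ≤ specNorm M * norm2 u * norm2 v := by
  refine (abs_dotProduct_le _ _).trans ?_
  have h : norm2 (M *ᵥ v) ≤ specNorm M * norm2 v := by
    rw [norm2_eq_norm, norm2_eq_norm, ← Matrix.toEuclideanCLM_toLp]
    exact ContinuousLinearMap.le_opNorm _ _
  nlinarith [norm2_nonneg u]

/-- Orthogonal diagonalization of a real symmetric matrix. -/
theorem exists_orthogonal_diagonalization [DecidableEq n] {M : Matrix n n ℝ} (hM : Mᵀ = M) :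
    ∃ (W : Matrix n n ℝ) (b : n → ℝ), Wᵀ * W = 1 ∧ W * Wᵀ = 1 ∧
      M = W * Matrix.diagonal b * Wᵀ := by
  have h : M.IsHermitian := by
    rw [Matrix.IsHermitian, Matrix.conjTranspose_eq_transpose_of_trivial, hM]
  refine ⟨h.eigenvectorUnitary, h.eigenvalues, ?_, ?_, ?_⟩
  · simpa [Matrix.star_eq_conjTranspose, Matrix.conjTranspose_eq_transpose_of_trivial] using
      Unitary.coe_star_mul_self h.eigenvectorUnitary
  · simpa [Matrix.star_eq_conjTranspose, Matrix.conjTranspose_eq_transpose_of_trivial] using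
      Unitary.coe_mul_star_self h.eigenvectorUnitary
  · conv_lhs => rw [h.spectral_theorem]
    simp [Unitary.conjStarAlgAut_apply, Matrix.star_eq_conjTranspose,
      Matrix.conjTranspose_eq_transpose_of_trivial]

variable {m : Type*} [Fintype m]

theorem dotProduct_transpose_mulVec {p q : Type*} [Fintype p] [Fintype q]
    (M : Matrix p q ℝ) (x : p → ℝ) (y : q → ℝ) :
    (Mᵀ *ᵥ x) ⬝ᵥ y = x ⬝ᵥ M *ᵥ y := by
  rw [Matrix.mulVec_transpose, Matrix.dotProduct_mulVec]

theorem dotProduct_mulVec_diagonal [DecidableEq m] {V : Matrix n m ℝ} (σ : m → ℝ) (x y : n → ℝ) :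
    x ⬝ᵥ (V * Matrix.diagonal σ * Vᵀ) *ᵥ y = ∑ i, σ i * ((Vᵀ *ᵥ x) i * (Vᵀ *ᵥ y) i) := by
  rw [← Matrix.mulVec_mulVec, ← Matrix.mulVec_mulVec, ← dotProduct_transpose_mulVec]
  simp only [dotProduct, Matrix.mulVec_diagonal]
  exact Finset.sum_congr rfl fun i _ => by ring

theorem dotProduct_transpose_mulVec_mulVec [DecidableEq n] {V : Matrix n m ℝ} (hV : V * Vᵀ = 1)
    (x y : n → ℝ) :
    (Vᵀ *ᵥ x) ⬝ᵥ (Vᵀ *ᵥ y) = x ⬝ᵥ y := by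
  rw [dotProduct_transpose_mulVec, Matrix.mulVec_mulVec, hV, Matrix.one_mulVec]

theorem transpose_mulVec_ne_zero [DecidableEq n] {V : Matrix n m ℝ} (hV : V * Vᵀ = 1)
    {x : n → ℝ} (hx : x ≠ 0) : Vᵀ *ᵥ x ≠ 0 := by
  intro h
  apply hx
  have := congrArg (V *ᵥ ·) h
  simpa [Matrix.mulVec_mulVec, hV] using this

variable {N : ℕ}

theorem IsSpectral.mul_transpose [DecidableEq n] {A : Matrix n n ℝ} {σ : Fin N → ℝ}
    {V : Matrix n (Fin N) ℝ} (h : IsSpectral A σ V) : V * Vᵀ = 1 :=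
  (Matrix.mul_eq_one_comm_of_card_eq _ _ _ (by rw [h.1, Fintype.card_fin])).1 h.2.2.1

theorem IsSpectral.eq [DecidableEq n] {A : Matrix n n ℝ} {σ : Fin N → ℝ}
    {V : Matrix n (Fin N) ℝ} (h : IsSpectral A σ V) : A = V * Matrix.diagonal σ * Vᵀ := by
  rw [← h.2.2.2, Matrix.mul_assoc, h.mul_transpose, Matrix.mul_one]

theorem IsSpectral.quad [DecidableEq n] {A : Matrix n n ℝ} {σ : Fin N → ℝ}
    {V : Matrix n (Fin N) ℝ} (h : IsSpectral A σ V) (x : n → ℝ) :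
    x ⬝ᵥ A *ᵥ x = ∑ i, σ i * (Vᵀ *ᵥ x) i ^ 2 := by
  conv_lhs => rw [h.eq]
  rw [dotProduct_mulVec_diagonal]
  simp [sq]

theorem IsSpectral.parseval [DecidableEq n] {A : Matrix n n ℝ} {σ : Fin N → ℝ}
    {V : Matrix n (Fin N) ℝ} (h : IsSpectral A σ V) (x : n → ℝ) :
    x ⬝ᵥ x = ∑ i, (Vᵀ *ᵥ x) i ^ 2 := by
  rw [← dotProduct_transpose_mulVec_mulVec h.mul_transpose x x]
  simp [dotProduct, sq]

theorem IsSpectral.apply [DecidableEq n] {A : Matrix n n ℝ} {σ : Fin N → ℝ}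
    {V : Matrix n (Fin N) ℝ} (h : IsSpectral A σ V) (i : Fin N) :
    A *ᵥ V.col i = σ i • V.col i := by
  have := congrArg (fun M : Matrix n (Fin N) ℝ => M.col i) h.2.2.2
  ext x
  have := congrFun this x
  simp only [Matrix.col_apply, Matrix.mul_diagonal] at this
  simp only [Pi.smul_apply, Matrix.col_apply, smul_eq_mul]
  rw [mul_comm, ← this]
  rfl

theorem IsSpectral.col_dotProduct_self {A : Matrix n n ℝ} {σ : Fin N → ℝ}
    {V : Matrix n (Fin N) ℝ} (h : IsSpectral A σ V) (i : Fin N) :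
    V.col i ⬝ᵥ V.col i = 1 := by
  have := congrFun (congrFun h.2.2.1 i) i
  simpa [Matrix.mul_apply, dotProduct] using this

theorem IsSpectral.nonneg [DecidableEq n] {A : Matrix n n ℝ} {σ : Fin N → ℝ}
    {V : Matrix n (Fin N) ℝ} (h : IsSpectral A σ V) (hA : ∀ x, 0 ≤ x ⬝ᵥ A *ᵥ x) (i : Fin N) :
    0 ≤ σ i := by
  have := hA (V.col i)
  rwa [h.apply, dotProduct_smul, h.col_dotProduct_self, smul_eq_mul, mul_one] at this

/-- The easy half of the Courant-Fischer principle: `k` linear constraints leave a vector whose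
Rayleigh quotient is at least the eigenvalue number `k`, counted from `0`. -/
theorem IsSpectral.exists_constrained [DecidableEq n] {A : Matrix n n ℝ} {σ : Fin N → ℝ}
    {V : Matrix n (Fin N) ℝ} (h : IsSpectral A σ V) (k : Fin N) {E : Type*} [AddCommGroup E]
    [Module ℝ E] [FiniteDimensional ℝ E] (hE : Module.finrank ℝ E ≤ k) (φ : (n → ℝ) →ₗ[ℝ] E) :
    ∃ x, x ≠ 0 ∧ φ x = 0 ∧ σ k * (x ⬝ᵥ x) ≤ x ⬝ᵥ A *ᵥ x := by
  -- Besides `φ`, the `N - 1 - k` coordinates after number `k` are set to zero: at most `N - 1`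
  -- constraints in dimension `N`.
  let ψ : (n → ℝ) →ₗ[ℝ] E × ({i : Fin N // k < i} → ℝ) :=
    φ.prod ((LinearMap.funLeft ℝ ℝ Subtype.val).comp Vᵀ.mulVecLin)
  have hcard : Fintype.card {i : Fin N // k < i} = N - 1 - k := by
    rw [Fintype.card_subtype, ← Fin.card_Ioi]
    congr 1
    ext i
    simp
  have hlt : Module.finrank ℝ (E × ({i : Fin N // k < i} → ℝ)) < Module.finrank ℝ (n → ℝ) := by
    rw [Module.finrank_prod, Module.finrank_fintype_fun_eq_card,
      Module.finrank_fintype_fun_eq_card, h.1, hcard]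
    have := k.2
    omega
  obtain ⟨x, hx, hx0⟩ := (Submodule.ne_bot_iff _).1 (LinearMap.ker_ne_bot_of_finrank_lt (f := ψ) hlt)
  have hx' : φ x = 0 ∧ 
      (LinearMap.funLeft ℝ ℝ (Subtype.val : {i : Fin N // k < i} → Fin N)) (Vᵀ *ᵥ x) = 0 := by
    exact Prod.mk_eq_zero.1 (LinearMap.mem_ker.1 hx)
  refine ⟨x, hx0, hx'.1, ?_⟩
  rw [h.quad, h.parseval, Finset.mul_sum]
  refine Finset.sum_le_sum fun i _ => ?_
  by_cases hi : k < i
  · have : (Vᵀ *ᵥ x) i = 0 := congrFun hx'.2 ⟨i, hi⟩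
    simp [this]
  · exact mul_le_mul_of_nonneg_right (h.2.1 (not_lt.1 hi)) (sq_nonneg _)

/-- Weyl's inequality. -/
theorem IsSpectral.weyl [DecidableEq n] {A B : Matrix n n ℝ} {σ τ : Fin N → ℝ}
    {V W : Matrix n (Fin N) ℝ} (hA : IsSpectral A σ V) (hB : IsSpectral B τ W) (k : Fin N) :
    σ k ≤ τ k + specNorm (A - B) := by
  -- The constraints kill the first `k` coordinates of `x` in the basis `W`, which caps the Rayleigh
  -- quotient of `B` by `τ k`.
  obtain ⟨x, hx0, hx, hle⟩ := hA.exists_constrained k (E := Fin k → ℝ) (by simp)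
    ((LinearMap.funLeft ℝ ℝ (Fin.castLE k.2.le)).comp Wᵀ.mulVecLin)
  have hBx : x ⬝ᵥ B *ᵥ x ≤ τ k * (x ⬝ᵥ x) := by
    rw [hB.quad, hB.parseval, Finset.mul_sum]
    refine Finset.sum_le_sum fun i _ => ?_
    by_cases hi : i < k
    · have : (Wᵀ *ᵥ x) i = 0 := congrFun hx ⟨i, hi⟩
      simp [this]
    · exact mul_le_mul_of_nonneg_right (hB.2.1 (not_lt.1 hi)) (sq_nonneg _)
  have h1 := (abs_le.1 (dotProduct_mulVec_le_specNorm (A - B) x x)).2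
  rw [Matrix.sub_mulVec, dotProduct_sub, mul_assoc, ← sq, norm2_sq] at h1
  have hpos : 0 < x ⬝ᵥ x := by
    have := norm2_pos hx0
    rw [← norm2_sq]
    positivity
  nlinarith

/-- A symmetric matrix whose positive eigenvalues are at most `c` has quadratic form at most
`c` times the square of the norm. -/
theorem quad_le_of_eigenvalue_le [DecidableEq n] {M : Matrix n n ℝ} (hM : Mᵀ = M) {c : ℝ}
    (hc : 0 ≤ c) (h : ∀ (μ : ℝ) (x : n → ℝ), x ≠ 0 → M *ᵥ x = μ • x → 0 < μ → μ ≤ c)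
    (w : n → ℝ) : w ⬝ᵥ M *ᵥ w ≤ c * (w ⬝ᵥ w) := by
  obtain ⟨W, b, h1, h2, rfl⟩ := exists_orthogonal_diagonalization hM
  rw [dotProduct_mulVec_diagonal, ← dotProduct_transpose_mulVec_mulVec h2 w w, dotProduct,
    Finset.mul_sum]
  refine Finset.sum_le_sum fun i _ => mul_le_mul_of_nonneg_right ?_ (mul_self_nonneg _)
  by_contra! hb
  refine hb.not_ge (h (b i) (W *ᵥ Pi.single i 1) ?_ ?_ (hc.trans_lt hb))
  · intro h0
    have := congrArg (fun v => (Wᵀ *ᵥ v) i) h0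
    simp only [Matrix.mulVec_mulVec, h1, Matrix.one_mulVec, Pi.single_eq_same,
      Matrix.mulVec_zero, Pi.zero_apply, one_ne_zero] at this
  · simp only [Matrix.mulVec_mulVec, Matrix.mul_assoc, h1, Matrix.mul_one]
    rw [← Matrix.mulVec_mulVec, ← Matrix.mulVec_smul]
    congr 1
    ext j
    by_cases hj : j = i
    · subst hj; simp
    · simp [hj]

/-- The orthogonal projection onto the span of the columns `k + 1, …, N` of `V`. -/
noncomputable def tailProj (k : ℕ) (V : Matrix n (Fin N) ℝ) : Matrix n n ℝ :=
  V * Matrix.diagonal (fun i : Fin N => if k ≤ (i : ℕ) then (1 : ℝ) else 0) * Vᵀ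

theorem tailProj_transpose {n : Type*} (k : ℕ) (V : Matrix n (Fin N) ℝ) : (tailProj k V)ᵀ = tailProj k V := by
  simp [tailProj, Matrix.transpose_mul, Matrix.mul_assoc]

theorem tailProj_mul_self (k : ℕ) {V : Matrix n (Fin N) ℝ} (h : Vᵀ * V = 1) :
    tailProj k V * tailProj k V = tailProj k V := by
  rw [tailProj]
  calc _ = V * (Matrix.diagonal (fun i : Fin N => if k ≤ (i : ℕ) then (1 : ℝ) else 0) * (Vᵀ * V) *
      Matrix.diagonal (fun i : Fin N => if k ≤ (i : ℕ) then 1 else 0)) * Vᵀ := by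
        simp only [Matrix.mul_assoc]
    _ = _ := by
        rw [h, Matrix.mul_one, Matrix.diagonal_mul_diagonal]
        congr 3
        ext i
        split_ifs <;> simp

theorem transpose_mulVec_tailProj (k : ℕ) {V : Matrix n (Fin N) ℝ} (h : Vᵀ * V = 1) (x : n → ℝ)
    (i : Fin N) :
    (Vᵀ *ᵥ (tailProj k V *ᵥ x)) i = if k ≤ (i : ℕ) then (Vᵀ *ᵥ x) i else 0 := by
  have : Vᵀ * tailProj k V =
      Matrix.diagonal (fun i : Fin N => if k ≤ (i : ℕ) then (1 : ℝ) else 0) * Vᵀ := by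
    rw [tailProj, ← Matrix.mul_assoc, ← Matrix.mul_assoc, h, Matrix.one_mul]
  rw [Matrix.mulVec_mulVec, this, ← Matrix.mulVec_mulVec, Matrix.mulVec_diagonal]
  split_ifs <;> simp

theorem tailProj_quad (k : ℕ) (V : Matrix n (Fin N) ℝ) (x : n → ℝ) :
    x ⬝ᵥ tailProj k V *ᵥ x = ∑ i : Fin N, if k ≤ (i : ℕ) then (Vᵀ *ᵥ x) i ^ 2 else 0 := by
  rw [tailProj, dotProduct_mulVec_diagonal]
  refine Finset.sum_congr rfl fun i _ => ?_
  split_ifs <;> simp [sq]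

theorem dotProduct_mulVec_comm_of_symm {M : Matrix n n ℝ} (h : Mᵀ = M) (x y : n → ℝ) :
    (M *ᵥ x) ⬝ᵥ y = x ⬝ᵥ M *ᵥ y := by
  conv_lhs => rw [← h]
  exact dotProduct_transpose_mulVec M x y

theorem IsSpectral.transpose_mulVec_mulVec [DecidableEq n] {A : Matrix n n ℝ} {σ : Fin N → ℝ}
    {V : Matrix n (Fin N) ℝ} (h : IsSpectral A σ V) (x : n → ℝ) (i : Fin N) :
    (Vᵀ *ᵥ (A *ᵥ x)) i = σ i * (Vᵀ *ᵥ x) i := by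
  have : Vᵀ * A = Matrix.diagonal σ * Vᵀ := by
    rw [h.eq, ← Matrix.mul_assoc, ← Matrix.mul_assoc, h.2.2.1, Matrix.one_mul]
  rw [Matrix.mulVec_mulVec, this, ← Matrix.mulVec_mulVec, Matrix.mulVec_diagonal]

theorem IsSpectral.dotProduct_mulVec [DecidableEq n] {A : Matrix n n ℝ} {σ : Fin N → ℝ}
    {V : Matrix n (Fin N) ℝ} (h : IsSpectral A σ V) (x y : n → ℝ) :
    x ⬝ᵥ A *ᵥ y = ∑ i, σ i * ((Vᵀ *ᵥ x) i * (Vᵀ *ᵥ y) i) := by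
  conv_lhs => rw [h.eq]
  exact dotProduct_mulVec_diagonal σ x y

/-- A Davis-Kahan bound for the spectral projections onto the low eigenspaces. -/
theorem IsSpectral.davisKahan [DecidableEq n] {A B : Matrix n n ℝ} {σ τ : Fin N → ℝ}
    {V W : Matrix n (Fin N) ℝ} (hA : IsSpectral A σ V) (hB : IsSpectral B τ W) {k : ℕ}
    (hkN : k < N) (hk' : k - 1 < N)
    (hgap : specNorm (A - B) < 1 / 2 * (σ ⟨k - 1, hk'⟩ - σ ⟨k, hkN⟩)) (w : n → ℝ) :
    w ⬝ᵥ tailProj k V *ᵥ w ≤ w ⬝ᵥ tailProj k W *ᵥ w +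
      2 * (specNorm (A - B) / (σ ⟨k - 1, hk'⟩ - σ ⟨k, hkN⟩)) * (w ⬝ᵥ w) := by
  set ε := specNorm (A - B) with hε
  set δ := σ ⟨k - 1, hk'⟩ - σ ⟨k, hkN⟩ with hδ
  have hε0 : 0 ≤ ε := specNorm_nonneg _
  have hδ0 : 0 < δ := by linarith
  set P := tailProj k V with hP
  set Q := tailProj k W with hQ
  have hPP : P * P = P := tailProj_mul_self k hA.2.2.1
  have hQQ : Q * Q = Q := tailProj_mul_self k hB.2.2.1
  have hPT : Pᵀ = P := tailProj_transpose k V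
  have hQT : Qᵀ = Q := tailProj_transpose k W
  have key := quad_le_of_eigenvalue_le (M := P - Q) (c := 2 * (ε / δ))
    (by rw [Matrix.transpose_sub, hPT, hQT]) (by positivity) ?_ w
  · rw [Matrix.sub_mulVec, dotProduct_sub] at key
    linarith
  -- An eigenvector of `P - Q` yields `u` in the low space of `A` and its component `z` in the high
  -- space of `B`. These satisfy `P z = μ² u` and `‖z‖ = μ ‖u‖`, so `μ` is the sine of an angle
  -- between the low spaces. Estimating `z ⬝ (A - B) u` in two ways bounds it.
  intro μ x hx hμ hμ0
  rw [Matrix.sub_mulVec] at hμ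
  set u := P *ᵥ x with hu
  have hPu : P *ᵥ u = u := by rw [hu, Matrix.mulVec_mulVec, hPP]
  have hQx : Q *ᵥ x = u - μ • x := by rw [← hμ]; abel
  have hQu : Q *ᵥ u = (1 + μ) • (u - μ • x) := by
    have := congrArg (Q *ᵥ ·) hQx
    simp only [Matrix.mulVec_mulVec, hQQ, Matrix.mulVec_sub, Matrix.mulVec_smul] at this
    rw [hQx] at this
    rw [add_smul, one_smul]
    nth_rewrite 1 [this]
    rw [sub_add_cancel]
  set z := u - Q *ᵥ u with hz
  have hPz : P *ᵥ z = (μ ^ 2) • u := by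
    rw [hz, Matrix.mulVec_sub, hPu, hQu, Matrix.mulVec_smul, Matrix.mulVec_sub, hPu,
      Matrix.mulVec_smul, ← hu]
    module
  have hQz : Q *ᵥ z = 0 := by
    rw [hz, Matrix.mulVec_sub, Matrix.mulVec_mulVec u Q Q, hQQ, sub_self]
  -- Otherwise `x` would be an eigenvector of the projection `Q` with the negative eigenvalue `-μ`.
  have hu0 : u ≠ 0 := by
    intro h0
    have h1 : x ⬝ᵥ Q *ᵥ x = - μ * (x ⬝ᵥ x) := by
      rw [hQx, h0, zero_sub, dotProduct_neg, dotProduct_smul, smul_eq_mul, neg_mul]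
    have h2 : x ⬝ᵥ Q *ᵥ x = (Q *ᵥ x) ⬝ᵥ (Q *ᵥ x) := by
      rw [dotProduct_mulVec_comm_of_symm hQT, Matrix.mulVec_mulVec, hQQ]
    have h3 := dotProduct_self_nonneg' (Q *ᵥ x)
    have h4 := norm2_sq x
    have h5 := norm2_pos hx
    nlinarith [mul_pos hμ0 (pow_pos h5 2)]
  have hup := norm2_pos hu0
  have huz : u ⬝ᵥ z = μ ^ 2 * (u ⬝ᵥ u) := by
    rw [← smul_eq_mul, ← dotProduct_smul, ← hPz, ← dotProduct_mulVec_comm_of_symm hPT, hPu]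
  have hzz : z ⬝ᵥ z = μ ^ 2 * (u ⬝ᵥ u) := by
    rw [← huz]
    conv_lhs => rw [hz]
    rw [sub_dotProduct, dotProduct_mulVec_comm_of_symm hQT, ← hz, hQz, dotProduct_zero, sub_zero]
  have hzn : norm2 z = μ * norm2 u := by
    rw [norm2, hzz, Real.sqrt_mul (sq_nonneg _), Real.sqrt_sq hμ0.le, norm2]
  have hcoordu : ∀ i : Fin N, ¬ k ≤ (i : ℕ) → (Vᵀ *ᵥ u) i = 0 := by
    intro i hi
    rw [hu, hP, transpose_mulVec_tailProj k hA.2.2.1, if_neg hi]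
  have hcoordz : ∀ i : Fin N, k ≤ (i : ℕ) → (Wᵀ *ᵥ z) i = 0 := by
    intro i hi
    have := transpose_mulVec_tailProj k hB.2.2.1 z i
    rw [if_pos hi, ← hQ, hQz, Matrix.mulVec_zero] at this
    exact this.symm
  -- `A u` stays in the range of `P`, so `z` may be replaced by `P z = μ² u`.
  have hzAu : z ⬝ᵥ A *ᵥ u ≤ μ ^ 2 * (σ ⟨k, hkN⟩ * (u ⬝ᵥ u)) := by
    have h1 : z ⬝ᵥ A *ᵥ u = μ ^ 2 * (u ⬝ᵥ A *ᵥ u) := by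
      have h2 : P *ᵥ (A *ᵥ u) = A *ᵥ u := by
        have h3 : Vᵀ *ᵥ (P *ᵥ (A *ᵥ u)) = Vᵀ *ᵥ (A *ᵥ u) := by
          ext i
          rw [hP, transpose_mulVec_tailProj k hA.2.2.1]
          split_ifs with hi
          · rfl
          · rw [hA.transpose_mulVec_mulVec, hcoordu i hi, mul_zero]
        have := congrArg (V *ᵥ ·) h3
        simpa only [Matrix.mulVec_mulVec, ← Matrix.mul_assoc, hA.mul_transpose, Matrix.one_mul] using this
      conv_lhs => rw [← h2]
      rw [← dotProduct_mulVec_comm_of_symm hPT, hPz, smul_dotProduct, smul_eq_mul]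
    rw [h1]
    refine mul_le_mul_of_nonneg_left ?_ (sq_nonneg μ)
    rw [hA.quad, hA.parseval, Finset.mul_sum]
    refine Finset.sum_le_sum fun i _ => ?_
    by_cases hi : k ≤ (i : ℕ)
    · exact mul_le_mul_of_nonneg_right (hA.2.1 (show (⟨k, hkN⟩ : Fin N) ≤ i from hi)) (sq_nonneg _)
    · simp [hcoordu i hi]
  -- In the basis `W`, `z` has only high coordinates, and there it agrees with `u`.
  have hzBu : τ ⟨k - 1, hk'⟩ * (z ⬝ᵥ z) ≤ z ⬝ᵥ B *ᵥ u := by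
    have h1 : z ⬝ᵥ B *ᵥ u = z ⬝ᵥ B *ᵥ z := by
      rw [hB.dotProduct_mulVec, hB.dotProduct_mulVec]
      refine Finset.sum_congr rfl fun i _ => ?_
      by_cases hi : k ≤ (i : ℕ)
      · simp [hcoordz i hi]
      · have : (Wᵀ *ᵥ z) i = (Wᵀ *ᵥ u) i := by
          rw [hz, Matrix.mulVec_sub, Pi.sub_apply, hQ, transpose_mulVec_tailProj k hB.2.2.1,
            if_neg hi, sub_zero]
        rw [this]
    rw [h1, hB.quad, hB.parseval, Finset.mul_sum]
    refine Finset.sum_le_sum fun i _ => ?_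
    by_cases hi : k ≤ (i : ℕ)
    · simp [hcoordz i hi]
    · refine mul_le_mul_of_nonneg_right (hB.2.1 (show i ≤ (⟨k - 1, hk'⟩ : Fin N) from ?_))
        (sq_nonneg _)
      exact Fin.le_def.2 (by simp; omega)
  have hweyl := hA.weyl hB ⟨k - 1, hk'⟩
  rw [← hε] at hweyl
  have hpert := (abs_le.1 (dotProduct_mulVec_le_specNorm (A - B) z u)).1
  rw [Matrix.sub_mulVec, dotProduct_sub, hzn, ← hε] at hpert
  rw [hzz] at hzBu
  rw [← norm2_sq] at hzAu hzBu
  have h1 : μ * norm2 u ^ 2 * (μ * (τ ⟨k - 1, hk'⟩ - σ ⟨k, hkN⟩)) ≤ μ * norm2 u ^ 2 * ε := by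
    nlinarith
  have h2 : μ * (τ ⟨k - 1, hk'⟩ - σ ⟨k, hkN⟩) ≤ ε :=
    le_of_mul_le_mul_left h1 (by positivity)
  -- By Weyl, passing from `σ` to `τ` at the upper end of the gap loses at most `ε < δ / 2`; half of
  -- the gap survives, whence the factor 2.
  have h3 : μ * (δ / 2) ≤ ε := by
    refine le_trans (mul_le_mul_of_nonneg_left ?_ hμ0.le) h2
    linarith
  rw [← mul_div_assoc, le_div_iff₀ hδ0]
  linarith

end Spectral

/-! ### The graph matrices, their positivity, and averaging over labeled points. -/

section Graph

variable {Xl Xu Yl : Type*} [Fintype Xl] [Fintype Xu] [Fintype Yl] (D : Data Xl Xu Yl)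

/-- The distribution of the augmentations of a natural sample drawn from `p`. -/
noncomputable def Data.mix (p : stdSimplex ℝ (Xl ⊕ Xu)) (x : Xl ⊕ Xu) : ℝ :=
  expect p fun a => (D.T a).1 x

theorem Data.adj_apply (x x' : Xl ⊕ Xu) :
    D.adj x x' = D.α * ∑ i, D.mix (D.Pl i) x * D.mix (D.Pl i) x' +
      D.β * ∑ a, D.Pu.1 a * ((D.T a).1 x * (D.T a).1 x') := by
  simp only [Data.adj, Matrix.of_apply, Data.mix, expect]
  congr 2
  refine Finset.sum_congr rfl fun i _ => ?_
  rw [Finset.sum_mul_sum]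
  refine Finset.sum_congr rfl fun a _ => ?_
  rw [Finset.mul_sum]
  exact Finset.sum_congr rfl fun b _ => by ring

theorem Data.adj_comm (x x' : Xl ⊕ Xu) : D.adj x x' = D.adj x' x := by
  simp only [Data.adj_apply, mul_comm]

theorem Data.sum_mix (p : stdSimplex ℝ (Xl ⊕ Xu)) : ∑ x, D.mix p x = 1 := by
  simp only [Data.mix, expect]
  rw [Finset.sum_comm]
  simp only [← Finset.mul_sum, (D.T _).2.2, mul_one, p.2.2]

/-- The summed-out endpoint has total mass one, so only marginals remain. This linearity is what
lets the three quadratic losses combine with weights `deg x * deg x'`. -/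
theorem Data.deg_eq (x : Xl ⊕ Xu) :
    D.deg x = D.α * ∑ i, D.mix (D.Pl i) x + D.β * D.mix D.Pu x := by
  simp only [Data.deg, Data.adj_apply, Finset.sum_add_distrib, ← Finset.mul_sum]
  congr 2
  · rw [Finset.sum_comm]
    simp only [← Finset.mul_sum, Data.sum_mix, mul_one]
  · rw [Finset.sum_comm]
    simp only [← Finset.mul_sum, (D.T _).2.2, mul_one]
    rfl

theorem Data.normAdj_comm (x x' : Xl ⊕ Xu) : D.normAdj x x' = D.normAdj x' x := by
  simp only [Data.normAdj, Matrix.of_apply, D.adj_comm x x', mul_comm]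

theorem Data.normAdj_transpose : D.normAdjᵀ = D.normAdj := by
  ext x x'
  exact D.normAdj_comm x' x

/-- The adjacency matrix is a nonnegative combination of rank-one squares, one for each known class
and one for each natural sample. -/
theorem Data.adj_quad_nonneg (v : Xl ⊕ Xu → ℝ) : 0 ≤ v ⬝ᵥ D.adj *ᵥ v := by
  have h : v ⬝ᵥ D.adj *ᵥ v = D.α * ∑ i, (∑ x, v x * D.mix (D.Pl i) x) ^ 2 +
      D.β * ∑ a, D.Pu.1 a * (∑ x, v x * (D.T a).1 x) ^ 2 := by
    simp only [dotProduct, Matrix.mulVec, Data.adj_apply, add_mul, Finset.sum_add_distrib, mul_add]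
    congr 1
    · simp only [Finset.mul_sum, Finset.sum_mul, sq]
      conv_lhs =>
        enter [2, x]
        rw [Finset.sum_comm]
      rw [Finset.sum_comm]
      refine Finset.sum_congr rfl fun i _ => ?_
      rw [Finset.sum_comm]
      exact Finset.sum_congr rfl fun x _ => Finset.sum_congr rfl fun y _ => by ring
    · simp only [Finset.mul_sum, Finset.sum_mul, sq]
      conv_lhs =>
        enter [2, x]
        rw [Finset.sum_comm]
      rw [Finset.sum_comm]
      refine Finset.sum_congr rfl fun i _ => ?_
      rw [Finset.sum_comm]
      exact Finset.sum_congr rfl fun x _ => Finset.sum_congr rfl fun y _ => by ring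
  rw [h]
  have hP : ∀ a, 0 ≤ D.Pu.1 a := D.Pu.2.1
  refine add_nonneg (mul_nonneg D.α_nonneg (Finset.sum_nonneg fun i _ => sq_nonneg _))
    (mul_nonneg D.β_nonneg (Finset.sum_nonneg fun a _ => mul_nonneg (hP a) (sq_nonneg _)))

theorem Data.normAdj_quad_nonneg (v : Xl ⊕ Xu → ℝ) : 0 ≤ v ⬝ᵥ D.normAdj *ᵥ v := by
  refine (D.adj_quad_nonneg fun x => v x / √(D.deg x)).trans_eq ?_
  simp only [dotProduct, Matrix.mulVec, Data.normAdj, Matrix.of_apply, Finset.mul_sum]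
  exact Finset.sum_congr rfl fun x _ => Finset.sum_congr rfl fun y _ => by
    simp only [div_eq_mul_inv, mul_inv]
    ring

theorem Data.avgAdj_mulVec_inl (v : Xl ⊕ Xu → ℝ) (a : Xl) :
    (D.avgAdj *ᵥ v) (Sum.inl a) = D.etaL * ∑ b, v (Sum.inl b) +
      ∑ x, D.etaU x * v (Sum.inr x) := by
  simp only [Matrix.mulVec, dotProduct, Fintype.sum_sum_type, Data.avgAdj,
    Matrix.fromBlocks_apply₁₁, Matrix.fromBlocks_apply₁₂, Matrix.of_apply, Finset.mul_sum,
    Data.etaU, D.normAdj_comm (Sum.inl _) (Sum.inr _)]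

theorem Data.avgAdj_mulVec_inr (v : Xl ⊕ Xu → ℝ) (x : Xu) :
    (D.avgAdj *ᵥ v) (Sum.inr x) = (∑ b, v (Sum.inl b)) * D.etaU x +
      (D.Auu *ᵥ fun x => v (Sum.inr x)) x := by
  simp only [Matrix.mulVec, dotProduct, Fintype.sum_sum_type, Data.avgAdj,
    Matrix.fromBlocks_apply₂₁, Matrix.fromBlocks_apply₂₂, Matrix.of_apply, Finset.sum_mul]
  congr 1
  exact Finset.sum_congr rfl fun x _ => mul_comm _ _

theorem Data.avgAdj_quad (v : Xl ⊕ Xu → ℝ) :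
    v ⬝ᵥ D.avgAdj *ᵥ v = D.etaL * (∑ b, v (Sum.inl b)) ^ 2 +
      2 * (∑ b, v (Sum.inl b)) * ∑ x, D.etaU x * v (Sum.inr x) +
      (fun x => v (Sum.inr x)) ⬝ᵥ D.Auu *ᵥ fun x => v (Sum.inr x) := by
  simp only [dotProduct, Fintype.sum_sum_type, D.avgAdj_mulVec_inl, D.avgAdj_mulVec_inr, mul_add,
    Finset.sum_add_distrib, ← Finset.sum_mul]
  have : ∑ x, v (Sum.inr x) * ((∑ b, v (Sum.inl b)) * D.etaU x) =
      (∑ b, v (Sum.inl b)) * ∑ x, D.etaU x * v (Sum.inr x) := by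
    rw [Finset.mul_sum]
    exact Finset.sum_congr rfl fun x _ => by ring
  rw [this]
  ring

/-- A vector that is constant on the labeled points sees only block averages, so here the form of
the normalized matrix agrees with that of the averaged one at labeled sum `t`. Positivity of
`avgAdj` and `Auu` follows. -/
theorem Data.normAdj_quad_averaged [Nonempty Xl] (t : ℝ) (u : Xu → ℝ) :
    (Sum.elim (fun _ => t / (Fintype.card Xl : ℝ)) u) ⬝ᵥ
        D.normAdj *ᵥ (Sum.elim (fun _ => t / (Fintype.card Xl : ℝ)) u) =
      D.etaL * t ^ 2 + 2 * t * (∑ x, D.etaU x * u x) + u ⬝ᵥ D.Auu *ᵥ u := by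
  have hN : (Fintype.card Xl : ℝ) ≠ 0 := by simp
  simp only [dotProduct, Matrix.mulVec, Fintype.sum_sum_type, Sum.elim_inl, Sum.elim_inr, mul_add,
    Finset.sum_add_distrib, Data.etaL, Data.etaU, Data.Auu, Matrix.toBlocks₂₂, Matrix.of_apply,
    ← Finset.mul_sum, ← Finset.sum_mul]
  have h1 : ∑ a : Xl, ∑ x, D.normAdj (Sum.inl a) (Sum.inr x) * u x =
      ∑ x, (∑ a : Xl, D.normAdj (Sum.inr x) (Sum.inl a)) * u x := by
    rw [Finset.sum_comm]
    simp only [Finset.sum_mul, D.normAdj_comm (Sum.inl _) (Sum.inr _)]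
  have h2 : ∑ x, u x * ((∑ a : Xl, D.normAdj (Sum.inr x) (Sum.inl a)) *
      (t / (Fintype.card Xl : ℝ))) =
      (t / (Fintype.card Xl : ℝ)) * ∑ x, (∑ a : Xl, D.normAdj (Sum.inr x) (Sum.inl a)) * u x := by
    rw [Finset.mul_sum]
    exact Finset.sum_congr rfl fun x _ => by ring
  have h3 : ∑ x, (∑ a : Xl, D.normAdj (Sum.inr x) (Sum.inl a)) / (Fintype.card Xl : ℝ) * u x =
      (∑ x, (∑ a : Xl, D.normAdj (Sum.inr x) (Sum.inl a)) * u x) / (Fintype.card Xl : ℝ) := by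
    rw [Finset.sum_div]
    exact Finset.sum_congr rfl fun x _ => by ring
  rw [h1, h2, h3]
  field_simp
  ring

theorem Data.averaged_quad_nonneg [Nonempty Xl] (t : ℝ) (u : Xu → ℝ) :
    0 ≤ D.etaL * t ^ 2 + 2 * t * (∑ x, D.etaU x * u x) + u ⬝ᵥ D.Auu *ᵥ u :=
  (D.normAdj_quad_averaged t u) ▸ D.normAdj_quad_nonneg _

theorem Data.avgAdj_quad_nonneg [Nonempty Xl] (v : Xl ⊕ Xu → ℝ) : 0 ≤ v ⬝ᵥ D.avgAdj *ᵥ v := by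
  rw [D.avgAdj_quad]
  exact D.averaged_quad_nonneg _ _

theorem Data.Auu_quad_nonneg [Nonempty Xl] (u : Xu → ℝ) : 0 ≤ u ⬝ᵥ D.Auu *ᵥ u := by
  simpa using D.averaged_quad_nonneg 0 u

/-! ### The contrastive loss as a matrix factorization objective. -/

section Loss

variable {k : ℕ} (f : Xl ⊕ Xu → Fin k → ℝ)

theorem Data.expect_mix (p q : stdSimplex ℝ (Xl ⊕ Xu)) (G : Xl ⊕ Xu → Xl ⊕ Xu → ℝ) :
    (expect p fun a => expect q fun b => expect (D.T a) fun x => expect (D.T b) fun x' => G x x') =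
      ∑ x, ∑ x', D.mix p x * D.mix q x' * G x x' := by
  simp only [expect, Data.mix]
  calc _ = ∑ a, ∑ b, ∑ x, ∑ x', p.1 a * (D.T a).1 x * (q.1 b * (D.T b).1 x') * G x x' := by
        refine Finset.sum_congr rfl fun a _ => ?_
        rw [Finset.mul_sum]
        refine Finset.sum_congr rfl fun b _ => ?_
        rw [Finset.mul_sum, Finset.mul_sum]
        refine Finset.sum_congr rfl fun x _ => ?_
        rw [Finset.mul_sum, Finset.mul_sum, Finset.mul_sum]
        exact Finset.sum_congr rfl fun x' _ => by ring
    _ = ∑ x, ∑ x', ∑ a, ∑ b, p.1 a * (D.T a).1 x * (q.1 b * (D.T b).1 x') * G x x' := by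
        conv_lhs =>
          enter [2, a]
          rw [Finset.sum_comm]
          enter [2, x]
          rw [Finset.sum_comm]
        rw [Finset.sum_comm]
        refine Finset.sum_congr rfl fun x _ => ?_
        rw [Finset.sum_comm]
    _ = _ := by
        refine Finset.sum_congr rfl fun x _ => Finset.sum_congr rfl fun x' _ => ?_
        rw [Finset.sum_mul_sum, Finset.sum_mul]
        refine Finset.sum_congr rfl fun a _ => ?_
        rw [Finset.sum_mul]

theorem Data.expect_same (p : stdSimplex ℝ (Xl ⊕ Xu)) (G : Xl ⊕ Xu → Xl ⊕ Xu → ℝ) :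
    (expect p fun a => expect (D.T a) fun x => expect (D.T a) fun x' => G x x') =
      ∑ x, ∑ x', (∑ a, p.1 a * ((D.T a).1 x * (D.T a).1 x')) * G x x' := by
  simp only [expect]
  calc _ = ∑ a, ∑ x, ∑ x', p.1 a * ((D.T a).1 x * (D.T a).1 x') * G x x' := by
        refine Finset.sum_congr rfl fun a _ => ?_
        rw [Finset.mul_sum]
        refine Finset.sum_congr rfl fun x _ => ?_
        rw [Finset.mul_sum, Finset.mul_sum]
        exact Finset.sum_congr rfl fun x' _ => by ring
    _ = ∑ x, ∑ x', ∑ a, p.1 a * ((D.T a).1 x * (D.T a).1 x') * G x x' := by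
        rw [Finset.sum_comm]
        refine Finset.sum_congr rfl fun x _ => ?_
        rw [Finset.sum_comm]
    _ = _ := by
        refine Finset.sum_congr rfl fun x _ => Finset.sum_congr rfl fun x' _ => ?_
        rw [Finset.sum_mul]

theorem Data.loss_linear :
    D.α * D.loss1 f + D.β * D.loss2 f = ∑ x, ∑ x', D.adj x x' * (f x ⬝ᵥ f x') := by
  simp only [Data.loss1, Data.loss2, D.expect_mix _ _ fun x x' => f x ⬝ᵥ f x',
    D.expect_same _ fun x x' => f x ⬝ᵥ f x', Data.adj_apply, add_mul, Finset.sum_add_distrib]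
  congr 1
  · simp only [Finset.mul_sum, Finset.sum_mul]
    rw [Finset.sum_comm]
    refine Finset.sum_congr rfl fun x _ => ?_
    rw [Finset.sum_comm]
    exact Finset.sum_congr rfl fun x' _ => Finset.sum_congr rfl fun i _ => by ring
  · simp only [Finset.mul_sum]
    exact Finset.sum_congr rfl fun x _ => Finset.sum_congr rfl fun x' _ => by
      rw [← Finset.mul_sum]; ring

theorem Data.loss_quadratic :
    D.α ^ 2 * D.loss3 f + 2 * D.α * D.β * D.loss4 f + D.β ^ 2 * D.loss5 f =
      ∑ x, ∑ x', D.deg x * D.deg x' * (f x ⬝ᵥ f x') ^ 2 := by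
  set G : Xl ⊕ Xu → Xl ⊕ Xu → ℝ := fun x x' => (f x ⬝ᵥ f x') ^ 2 with hG
  set L : Xl ⊕ Xu → ℝ := fun x => ∑ i, D.mix (D.Pl i) x with hL
  have h3 : D.loss3 f = ∑ x, ∑ x', L x * L x' * G x x' := by
    simp only [Data.loss3, D.expect_mix _ _ fun x x' => (f x ⬝ᵥ f x') ^ 2, hL]
    calc _ = ∑ x, ∑ x', ∑ i, ∑ j, D.mix (D.Pl i) x * D.mix (D.Pl j) x' * G x x' := by
          conv_lhs =>
            enter [2, i]
            rw [Finset.sum_comm]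
            enter [2, x]
            rw [Finset.sum_comm]
          rw [Finset.sum_comm]
          refine Finset.sum_congr rfl fun x _ => ?_
          rw [Finset.sum_comm]
      _ = _ := by
          refine Finset.sum_congr rfl fun x _ => Finset.sum_congr rfl fun x' _ => ?_
          rw [Finset.sum_mul_sum, Finset.sum_mul]
          refine Finset.sum_congr rfl fun a _ => ?_
          rw [Finset.sum_mul]
  have h4 : D.loss4 f = ∑ x, ∑ x', L x * D.mix D.Pu x' * G x x' := by
    simp only [Data.loss4, D.expect_mix _ _ fun x x' => (f x ⬝ᵥ f x') ^ 2, hL]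
    rw [Finset.sum_comm]
    refine Finset.sum_congr rfl fun x _ => ?_
    rw [Finset.sum_comm]
    refine Finset.sum_congr rfl fun x' _ => ?_
    rw [Finset.sum_mul, Finset.sum_mul]
  -- The product `deg x * deg x'` has two cross terms; by symmetry of `G` each one accounts for half
  -- of the mixed loss.
  have h4' : D.loss4 f = ∑ x, ∑ x', D.mix D.Pu x * L x' * G x x' := by
    rw [h4, Finset.sum_comm]
    refine Finset.sum_congr rfl fun x _ => Finset.sum_congr rfl fun x' _ => ?_
    rw [hG]
    simp only
    rw [dotProduct_comm (f x)]
    ring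
  have h5 : D.loss5 f = ∑ x, ∑ x', D.mix D.Pu x * D.mix D.Pu x' * G x x' := by
    simp only [Data.loss5, D.expect_mix _ _ fun x x' => (f x ⬝ᵥ f x') ^ 2]
    rfl
  have : D.α ^ 2 * D.loss3 f + 2 * D.α * D.β * D.loss4 f + D.β ^ 2 * D.loss5 f =
      D.α ^ 2 * D.loss3 f + D.α * D.β * D.loss4 f + D.α * D.β * D.loss4 f +
        D.β ^ 2 * D.loss5 f := by ring
  rw [this]
  nth_rewrite 2 [h4']
  rw [h3, h4, h5]
  simp only [Finset.mul_sum, ← Finset.sum_add_distrib]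
  refine Finset.sum_congr rfl fun x _ => Finset.sum_congr rfl fun x' _ => ?_
  rw [D.deg_eq, D.deg_eq]
  ring

/-- The matrix with rows `√w_x f(x)`. -/
noncomputable def Data.weighted : Matrix (Xl ⊕ Xu) (Fin k) ℝ :=
  Matrix.of fun x j => √(D.deg x) * f x j

/-- Up to an additive constant, the loss is the squared Frobenius distance between the normalized
adjacency matrix and the Gram matrix of the weighted features. -/
theorem Data.nscl_eq (hdeg : ∀ x, 0 < D.deg x) :
    D.nscl f = Matrix.trace ((D.normAdj - D.weighted f * (D.weighted f)ᵀ) *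
        (D.normAdj - D.weighted f * (D.weighted f)ᵀ)ᵀ) -
      Matrix.trace (D.normAdj * D.normAdjᵀ) := by
  have h : D.nscl f = (D.α ^ 2 * D.loss3 f + 2 * D.α * D.β * D.loss4 f + D.β ^ 2 * D.loss5 f) -
      2 * (D.α * D.loss1 f + D.β * D.loss2 f) := by
    rw [Data.nscl]; ring
  rw [h, D.loss_linear, D.loss_quadratic]
  simp only [Matrix.trace, Matrix.diag_apply, Matrix.mul_apply, Matrix.transpose_apply,
    Matrix.sub_apply, ← Finset.sum_sub_distrib, Finset.mul_sum, Data.weighted, Matrix.of_apply]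
  refine Finset.sum_congr rfl fun x _ => Finset.sum_congr rfl fun x' _ => ?_
  have hG : ∑ j, √(D.deg x) * f x j * (√(D.deg x') * f x' j) =
      √(D.deg x) * √(D.deg x') * (f x ⬝ᵥ f x') := by
    rw [dotProduct, Finset.mul_sum]
    exact Finset.sum_congr rfl fun j _ => by ring
  have h1 := Real.sq_sqrt (hdeg x).le
  have h2 := Real.sq_sqrt (hdeg x').le
  have h3 : D.adj x x' = D.normAdj x x' * (√(D.deg x) * √(D.deg x')) := by
    rw [Data.normAdj, Matrix.of_apply, div_mul_cancel₀]
    have := Real.sqrt_pos.2 (hdeg x)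
    have := Real.sqrt_pos.2 (hdeg x')
    positivity
  rw [hG, h3]
  nth_rewrite 1 [← h1]
  nth_rewrite 1 [← h2]
  ring

end Loss

end Graph

/-! ### Best approximation by Gram matrices of bounded rank. -/

section LowRank

variable {n : Type*} [Fintype n]

theorem trace_mul_transpose_self_nonneg {m : Type*} [Fintype m] (M : Matrix n m ℝ) :
    0 ≤ Matrix.trace (M * Mᵀ) := by
  simp only [Matrix.trace, Matrix.diag_apply, Matrix.mul_apply, Matrix.transpose_apply]
  exact Finset.sum_nonneg fun i _ => Finset.sum_nonneg fun j _ => mul_self_nonneg _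

/-- The orthogonal projection onto the column space of a matrix. -/
theorem exists_proj_range [DecidableEq n] {m : Type*} [Fintype m] [DecidableEq m]
    (F : Matrix n m ℝ) :
    ∃ Z : Matrix m n ℝ, (F * Z)ᵀ = F * Z ∧ F * Z * F = F ∧
      Matrix.trace (F * Z) ≤ Fintype.card m := by
  obtain ⟨W, b, h1, h2, hb⟩ := exists_orthogonal_diagonalization (M := Fᵀ * F)
    (by simp [Matrix.transpose_mul])
  have hcancel : ∀ a c : m → ℝ, W * Matrix.diagonal a * Wᵀ * (W * Matrix.diagonal c * Wᵀ) =
      W * Matrix.diagonal (fun i => a i * c i) * Wᵀ := by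
    intro a c
    calc _ = W * (Matrix.diagonal a * (Wᵀ * W) * Matrix.diagonal c) * Wᵀ := by
          simp only [Matrix.mul_assoc]
      _ = _ := by rw [h1, Matrix.mul_one, Matrix.diagonal_mul_diagonal]
  -- Since `0⁻¹ = 0`, `K` is the pseudo-inverse of `Fᵀ F`, and `F K Fᵀ` is the projection sought.
  set K : Matrix m m ℝ := W * Matrix.diagonal (fun i => (b i)⁻¹) * Wᵀ with hK
  have hKT : Kᵀ = K := by simp [hK, Matrix.transpose_mul, Matrix.mul_assoc]
  refine ⟨K * Fᵀ, ?_, ?_, ?_⟩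
  · simp only [Matrix.transpose_mul, Matrix.transpose_transpose, hKT, Matrix.mul_assoc]
  -- `Y` projects onto the kernel of `Fᵀ F`, which is also the kernel of `F`.
  · set Y : Matrix m m ℝ := W * Matrix.diagonal (fun i => 1 - (b i)⁻¹ * b i) * Wᵀ with hY
    have hYT : Yᵀ = Y := by simp [hY, Matrix.transpose_mul, Matrix.mul_assoc]
    have hsum : K * (Fᵀ * F) = 1 - Y := by
      rw [hb, hK, hcancel, hY, eq_sub_iff_add_eq, ← Matrix.add_mul, ← Matrix.mul_add,
        Matrix.diagonal_add]
      simp [h2]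
    have hFY : F * Y = 0 := by
      have h0 : (F * Y)ᵀ * (F * Y) = 0 := by
        calc _ = Y * (Fᵀ * F) * Y := by
              rw [Matrix.transpose_mul, hYT]; simp only [Matrix.mul_assoc]
          _ = 0 := by
              rw [hb, hY, hcancel, hcancel]
              have : (fun i => (1 - (b i)⁻¹ * b i) * b i * (1 - (b i)⁻¹ * b i)) = 0 := by
                ext i
                by_cases hi : b i = 0 <;> simp [hi]
              rw [this]
              simp
      rw [← Matrix.conjTranspose_eq_transpose_of_trivial] at h0
      exact Matrix.conjTranspose_mul_self_eq_zero.1 h0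
    calc _ = F * (K * (Fᵀ * F)) := by simp only [Matrix.mul_assoc]
      _ = F := by rw [hsum, Matrix.mul_sub, hFY, Matrix.mul_one, sub_zero]
  · rw [Matrix.trace_mul_comm, Matrix.mul_assoc, hb, hK, hcancel, Matrix.mul_assoc,
      Matrix.trace_mul_comm, Matrix.mul_assoc, h1, Matrix.mul_one, Matrix.trace_diagonal]
    calc _ ≤ ∑ _i : m, (1 : ℝ) := Finset.sum_le_sum fun i _ => by
          by_cases hi : b i = 0 <;> simp [hi]
      _ = _ := by simp

variable {N : ℕ}

theorem trace_diag_conj [DecidableEq n] {V : Matrix n (Fin N) ℝ} (h : Vᵀ * V = 1)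
    (a : Fin N → ℝ) : Matrix.trace (V * Matrix.diagonal a * Vᵀ) = ∑ i, a i := by
  rw [Matrix.trace_mul_comm, ← Matrix.mul_assoc, h, Matrix.one_mul, Matrix.trace_diagonal]

theorem diag_conj_mul {V : Matrix n (Fin N) ℝ} (h : Vᵀ * V = 1) (a c : Fin N → ℝ) :
    V * Matrix.diagonal a * Vᵀ * (V * Matrix.diagonal c * Vᵀ) =
      V * Matrix.diagonal (fun i => a i * c i) * Vᵀ := by
  calc _ = V * (Matrix.diagonal a * (Vᵀ * V) * Matrix.diagonal c) * Vᵀ := by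
        simp only [Matrix.mul_assoc]
    _ = _ := by rw [h, Matrix.mul_one, Matrix.diagonal_mul_diagonal]

theorem sum_castLE {k : ℕ} (hk : k ≤ N) (g : Fin N → ℝ) :
    ∑ j : Fin k, g (Fin.castLE hk j) = ∑ i : Fin N, if (i : ℕ) < k then g i else 0 := by
  rw [← Finset.sum_filter]
  refine Finset.sum_bij (fun j _ => Fin.castLE hk j) ?_ ?_ ?_ ?_
  · intro j _; simp
  · intro a _ b _ h; simpa using h
  · intro i hi
    refine ⟨⟨i, by simpa using hi⟩, Finset.mem_univ _, rfl⟩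
  · intro j _; rfl

/-- The squared Frobenius distance of `A` to its truncation, written as a Gram matrix. -/
theorem IsSpectral.exists_truncation [DecidableEq n] {A : Matrix n n ℝ} {σ : Fin N → ℝ}
    {V : Matrix n (Fin N) ℝ} (h : IsSpectral A σ V) (h0 : ∀ i, 0 ≤ σ i) {k : ℕ} (hk : k ≤ N) :
    ∃ G : Matrix n (Fin k) ℝ, Matrix.trace ((A - G * Gᵀ) * (A - G * Gᵀ)ᵀ) =
      Matrix.trace (A * Aᵀ) - ∑ i : Fin N, if (i : ℕ) < k then σ i ^ 2 else 0 := by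
  refine ⟨Matrix.of fun x j => V x (Fin.castLE hk j) * √(σ (Fin.castLE hk j)), ?_⟩
  set G : Matrix n (Fin k) ℝ :=
    Matrix.of fun x j => V x (Fin.castLE hk j) * √(σ (Fin.castLE hk j)) with hG
  have hGG : G * Gᵀ = V * Matrix.diagonal (fun i : Fin N => if (i : ℕ) < k then σ i else 0) * Vᵀ := by
    ext x y
    rw [Matrix.mul_apply, Matrix.mul_apply]
    simp only [hG, Matrix.transpose_apply, Matrix.of_apply, Matrix.mul_diagonal]
    rw [sum_castLE hk fun i => V x i * √(σ i) * (V y i * √(σ i))]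
    refine Finset.sum_congr rfl fun i _ => ?_
    split_ifs
    · have := Real.mul_self_sqrt (h0 i)
      calc _ = V x i * (√(σ i) * √(σ i)) * V y i := by ring
        _ = _ := by rw [this]
    · simp
  have hsub : A - G * Gᵀ =
      V * Matrix.diagonal (fun i : Fin N => if (i : ℕ) < k then 0 else σ i) * Vᵀ := by
    rw [hGG]
    conv_lhs => rw [h.eq]
    rw [← Matrix.sub_mul, ← Matrix.mul_sub, Matrix.diagonal_sub]
    congr 3
    ext i
    split_ifs <;> simp
  have hT : ∀ a : Fin N → ℝ, (V * Matrix.diagonal a * Vᵀ)ᵀ = V * Matrix.diagonal a * Vᵀ := by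
    intro a
    simp [Matrix.transpose_mul, Matrix.mul_assoc]
  rw [hsub, hT, diag_conj_mul h.2.2.1, trace_diag_conj h.2.2.1]
  conv_rhs => rw [h.eq]
  rw [hT, diag_conj_mul h.2.2.1, trace_diag_conj h.2.2.1, ← Finset.sum_sub_distrib]
  refine Finset.sum_congr rfl fun i _ => ?_
  split_ifs <;> ring

/-- Approximation by a matrix supported on the range of the projection `R`. -/
theorem trace_sub_sq_ge [DecidableEq n] {A B R : Matrix n n ℝ} (hA : Aᵀ = A) (hB : Bᵀ = B)
    (hR : Rᵀ = R) (hRR : R * R = R) (hRB : R * B = B) :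
    Matrix.trace (A * Aᵀ) - Matrix.trace (R * (A * A)) ≤
      Matrix.trace ((A - B) * (A - B)ᵀ) := by
  have hBR : B * R = B := by
    have := congrArg Matrix.transpose hRB
    rwa [Matrix.transpose_mul, hR, hB] at this
  -- `B` pairs with `A` as it does with the compression `C`. Completing the square with `‖C - B‖² ≥
  -- 0` leaves `tr C²`, and `‖R A (1 - R)‖² ≥ 0` bounds this by `tr (R A²)`.
  set C := R * A * R with hC
  have hCT : Cᵀ = C := by simp [hC, Matrix.transpose_mul, hR, hA, Matrix.mul_assoc]
  have h1 := trace_mul_transpose_self_nonneg (C - B)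
  have h2 := trace_mul_transpose_self_nonneg (R * A * (1 - R))
  have hCB : Matrix.trace (C * B) = Matrix.trace (A * B) := by
    rw [hC, Matrix.mul_assoc, hRB, Matrix.mul_assoc, Matrix.trace_mul_comm, Matrix.mul_assoc, hBR]
  have hCC : Matrix.trace (C * C) = Matrix.trace (R * A * R * A) := by
    have : C * C = R * A * R * A * R := by
      calc _ = R * A * (R * R) * A * R := by rw [hC]; simp only [Matrix.mul_assoc]
        _ = _ := by rw [hRR]
    rw [this, Matrix.trace_mul_comm]
    simp only [← Matrix.mul_assoc, hRR]
  have h3 : Matrix.trace (R * A * (1 - R) * (R * A * (1 - R))ᵀ) =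
      Matrix.trace (R * (A * A)) - Matrix.trace (R * A * R * A) := by
    have e : R * A * (1 - R) * (R * A * (1 - R))ᵀ = (R * A * A - R * A * R * A) * R := by
      rw [Matrix.transpose_mul, Matrix.transpose_mul, Matrix.transpose_sub, hR, hA,
        Matrix.transpose_one]
      have : (1 - R) * (1 - R) = 1 - R := by
        rw [Matrix.mul_sub, Matrix.mul_one, Matrix.sub_mul, Matrix.one_mul, hRR, sub_self, sub_zero]
      calc _ = R * A * ((1 - R) * (1 - R)) * A * R := by simp only [Matrix.mul_assoc]
        _ = _ := by
          rw [this]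
          simp only [Matrix.mul_sub, Matrix.sub_mul, Matrix.mul_one]
    rw [e, Matrix.trace_mul_comm, Matrix.mul_sub, Matrix.trace_sub]
    simp only [← Matrix.mul_assoc, hRR]
  rw [h3] at h2
  rw [Matrix.transpose_sub, hCT, hB, Matrix.sub_mul, Matrix.mul_sub, Matrix.mul_sub,
    Matrix.trace_sub, Matrix.trace_sub, Matrix.trace_sub, Matrix.trace_mul_comm B C, hCB, hCC] at h1
  rw [Matrix.transpose_sub, hA, hB, Matrix.sub_mul, Matrix.mul_sub, Matrix.mul_sub,
    Matrix.trace_sub, Matrix.trace_sub, Matrix.trace_sub, Matrix.trace_mul_comm B A]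
  linarith

/-- The column space of a best approximation of `A` by a Gram matrix of rank at most `k` contains
the top `k` eigenvectors, if there is an eigengap. -/
theorem IsSpectral.top_mem_range_of_minimizer [DecidableEq n] {A : Matrix n n ℝ} {σ : Fin N → ℝ}
    {V : Matrix n (Fin N) ℝ} (h : IsSpectral A σ V) (hAT : Aᵀ = A) (h0 : ∀ i, 0 ≤ σ i) {k : ℕ}
    (hk : 0 < k) (hkN : k < N) (hk' : k - 1 < N) (hgap : σ ⟨k, hkN⟩ < σ ⟨k - 1, hk'⟩)
    {F : Matrix n (Fin k) ℝ}
    (hF : ∀ G : Matrix n (Fin k) ℝ, Matrix.trace ((A - F * Fᵀ) * (A - F * Fᵀ)ᵀ) ≤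
      Matrix.trace ((A - G * Gᵀ) * (A - G * Gᵀ)ᵀ)) (i : Fin N) (hi : (i : ℕ) < k) :
    ∃ c, F *ᵥ c = V.col i := by
  obtain ⟨Z, hRT, hRF, htr⟩ := exists_proj_range F
  set R := F * Z with hR
  have hRR : R * R = R := by
    rw [hR, ← Matrix.mul_assoc, hRF]
  obtain ⟨G, hG⟩ := h.exists_truncation h0 hkN.le
  have hmin := hF G
  rw [hG] at hmin
  have hge := trace_sub_sq_ge (A := A) (B := F * Fᵀ) (R := R) hAT
    (by simp [Matrix.transpose_mul]) hRT hRR (by rw [← Matrix.mul_assoc, hRF])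
  -- `ρ i` is the squared length of the projection of the eigenvector `i` to the column space of
  -- `F`. These weights lie in `[0, 1]` and sum to at most `k`.
  set ρ : Fin N → ℝ := fun i => V.col i ⬝ᵥ R *ᵥ V.col i with hρ
  have hρ' : ∀ i, (Vᵀ * R * V) i i = ρ i := by
    intro i
    rw [hρ, Matrix.mul_assoc, Matrix.mul_apply]
    rfl
  have hρR : ∀ i, ρ i = (R *ᵥ V.col i) ⬝ᵥ (R *ᵥ V.col i) := by
    intro i
    rw [dotProduct_mulVec_comm_of_symm hRT, Matrix.mulVec_mulVec, hRR]
  have hρ1 : ∀ i, (V.col i - R *ᵥ V.col i) ⬝ᵥ (V.col i - R *ᵥ V.col i) = 1 - ρ i := by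
    intro i
    rw [sub_dotProduct, dotProduct_sub, dotProduct_sub, ← hρR, h.col_dotProduct_self,
      dotProduct_comm (R *ᵥ V.col i)]
    simp only [hρ]
    ring
  have hρ0 : ∀ i, 0 ≤ ρ i := fun i => by rw [hρR]; exact dotProduct_self_nonneg' _
  have hρle : ∀ i, ρ i ≤ 1 := fun i => by
    have := dotProduct_self_nonneg' (V.col i - R *ᵥ V.col i)
    rw [hρ1] at this
    linarith
  have hAA : A * A = V * Matrix.diagonal (fun i => σ i * σ i) * Vᵀ := by
    conv_lhs => rw [h.eq]
    exact diag_conj_mul h.2.2.1 σ σ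
  have htrA : Matrix.trace (R * (A * A)) = ∑ i, σ i ^ 2 * ρ i := by
    rw [hAA, ← Matrix.mul_assoc, Matrix.trace_mul_comm, ← Matrix.mul_assoc, ← Matrix.mul_assoc,
      Matrix.trace]
    refine Finset.sum_congr rfl fun i _ => ?_
    rw [Matrix.diag_apply, Matrix.mul_diagonal, hρ']
    ring
  have htrR : ∑ i, ρ i ≤ k := by
    have : ∑ i, ρ i = Matrix.trace R := by
      calc _ = Matrix.trace (Vᵀ * R * V) := by
            rw [Matrix.trace]
            exact Finset.sum_congr rfl fun i _ => (hρ' i).symm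
        _ = _ := by
            rw [Matrix.trace_mul_comm, ← Matrix.mul_assoc, h.mul_transpose, Matrix.one_mul]
    rw [this]
    simpa using htr
  have hχk : (∑ i : Fin N, if (i : ℕ) < k then (1 : ℝ) else 0) = k := by
    rw [← sum_castLE hkN.le fun _ => 1]
    simp
  set χ : Fin N → ℝ := fun i => if (i : ℕ) < k then 1 else 0 with hχ
  set t := σ ⟨k, hkN⟩ with ht
  -- After the shift by `t²` both factors have the same sign, while optimality and `∑ ρ ≤ k` make
  -- the sum nonpositive. So all terms vanish, and the gap forces `ρ i = 1` for `i < k`.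
  have hterm : ∀ i, 0 ≤ (χ i - ρ i) * (σ i ^ 2 - t ^ 2) := by
    intro i
    simp only [hχ]
    split_ifs with hi
    · refine mul_nonneg (by linarith [hρle i]) ?_
      have : t ≤ σ i := h.2.1 (show i ≤ ⟨k, hkN⟩ from Fin.le_def.2 hi.le)
      nlinarith [h0 ⟨k, hkN⟩]
    · have : σ i ≤ t := h.2.1 (show (⟨k, hkN⟩ : Fin N) ≤ i from Fin.le_def.2 (not_lt.1 hi))
      refine mul_nonneg_of_nonpos_of_nonpos (by linarith [hρ0 i]) ?_
      nlinarith [h0 i]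
  have hsum : ∑ i, (χ i - ρ i) * (σ i ^ 2 - t ^ 2) ≤ 0 := by
    have e : ∑ i, (χ i - ρ i) * (σ i ^ 2 - t ^ 2) =
        ((∑ i : Fin N, if (i : ℕ) < k then σ i ^ 2 else 0) - ∑ i, σ i ^ 2 * ρ i) -
          t ^ 2 * ((∑ i, χ i) - ∑ i, ρ i) := by
      rw [← Finset.sum_sub_distrib, ← Finset.sum_sub_distrib, Finset.mul_sum,
        ← Finset.sum_sub_distrib]
      refine Finset.sum_congr rfl fun i _ => ?_
      simp only [hχ]
      split_ifs <;> ring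
    rw [e, hχk]
    rw [htrA] at hge
    nlinarith [sq_nonneg t]
  have hzero := (Finset.sum_eq_zero_iff_of_nonneg fun i _ => hterm i).1
    (le_antisymm hsum (Finset.sum_nonneg fun i _ => hterm i)) i (Finset.mem_univ i)
  have hσi : t < σ i := hgap.trans_le
    (h.2.1 (show i ≤ (⟨k - 1, hk'⟩ : Fin N) from Fin.le_def.2 (by simp; omega)))
  have ht0 : 0 ≤ t := h0 _
  have hρi : 1 - ρ i = 0 := by
    simp only [hχ, if_pos hi] at hzero
    rcases mul_eq_zero.1 hzero with h | h
    · exact h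
    · nlinarith
  have hfix := hρ1 i
  rw [hρi] at hfix
  refine ⟨Z *ᵥ V.col i, ?_⟩
  rw [Matrix.mulVec_mulVec, ← hR]
  exact (sub_eq_zero.1 (dotProduct_self_eq_zero.1 hfix)).symm

end LowRank

/-! ### Cosines and projection onto a line. -/

section Cosine

variable {n : Type*} [Fintype n]

/-- For nonzero vectors this is cancellation. In the degenerate cases both sides are `0` (by
Cauchy-Schwarz if `a` vanishes), so later uses need no case distinction. -/
theorem norm2_sq_mul_cosine_sq (a b : n → ℝ) :
    norm2 a ^ 2 * cosine a b ^ 2 = (a ⬝ᵥ b) ^ 2 / norm2 b ^ 2 := by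
  rw [cosine, div_pow, mul_pow]
  by_cases ha : norm2 a = 0
  · have : a ⬝ᵥ b = 0 := by
      have := abs_dotProduct_le a b
      rw [ha, zero_mul] at this
      exact abs_nonpos_iff.1 this
    simp [ha, this]
  · by_cases hb : norm2 b = 0
    · simp [hb]
    · field_simp

theorem cosine_sq_le_one (a b : n → ℝ) : cosine a b ^ 2 ≤ 1 := by
  rw [cosine, sq_le_one_iff_abs_le_one, abs_div,
    abs_of_nonneg (mul_nonneg (norm2_nonneg a) (norm2_nonneg b))]
  exact div_le_one_of_le₀ (abs_dotProduct_le a b) (mul_nonneg (norm2_nonneg a) (norm2_nonneg b))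

/-- The squared distance of `a` to its projection onto the line spanned by `b`. -/
theorem dotProduct_sub_proj (a b : n → ℝ) :
    (a - (a ⬝ᵥ b / norm2 b ^ 2) • b) ⬝ᵥ (a - (a ⬝ᵥ b / norm2 b ^ 2) • b) =
      norm2 a ^ 2 * (1 - cosine a b ^ 2) := by
  rw [mul_sub, norm2_sq_mul_cosine_sq, mul_one, norm2_sq, norm2_sq, sub_dotProduct, dotProduct_sub,
    dotProduct_sub, dotProduct_smul, smul_dotProduct, smul_dotProduct, dotProduct_smul,
    dotProduct_comm b a]
  simp only [smul_eq_mul]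
  by_cases hb : b ⬝ᵥ b = 0
  · simp [hb]
  · field_simp
    ring

end Cosine

/-! ### Low spectral components of vectors that are constant on labeled points. -/

section Tail

variable {Xl Xu : Type*} [Fintype Xl] [Fintype Xu] {N : ℕ} (k : ℕ)
  (V : Matrix (Xl ⊕ Xu) (Fin N) ℝ)

theorem transpose_mulVec_elim_const (t : ℝ) (y : Xu → ℝ) (i : {i : Fin N // k ≤ (i : ℕ)}) :
    (Vᵀ *ᵥ (Sum.elim (fun _ => -t) y)) i.1 = ((Uflat k V)ᵀ *ᵥ y - t • lflat k V) i := by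
  simp only [Matrix.mulVec, dotProduct, Fintype.sum_sum_type, Matrix.transpose_apply, Sum.elim_inl,
    Sum.elim_inr, Pi.sub_apply, Pi.smul_apply, lflat, Uflat, Lflat, Matrix.of_apply, mul_one,
    ← Finset.sum_mul, smul_eq_mul]
  ring

theorem sum_tail (g : Fin N → ℝ) :
    ∑ i : {i : Fin N // k ≤ (i : ℕ)}, g i.1 = ∑ i : Fin N, if k ≤ (i : ℕ) then g i else 0 := by
  rw [← Finset.sum_filter]
  exact (Finset.sum_subtype _ (by simp) g).symm

/-- The low coordinates of such a vector depend affinely on `t` with direction `lflat`, so choosing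
the labeled value amounts to projecting along `lflat`. -/
theorem tailProj_quad_elim_const (t : ℝ) (y : Xu → ℝ) :
    (Sum.elim (fun _ => -t) y) ⬝ᵥ tailProj k V *ᵥ (Sum.elim (fun _ : Xl => -t) y) =
      ((Uflat k V)ᵀ *ᵥ y - t • lflat k V) ⬝ᵥ ((Uflat k V)ᵀ *ᵥ y - t • lflat k V) := by
  rw [tailProj_quad, ← sum_tail k fun i => (Vᵀ *ᵥ (Sum.elim (fun _ => -t) y)) i ^ 2]
  simp only [transpose_mulVec_elim_const, dotProduct, sq]

theorem elim_const_dotProduct_self (t : ℝ) (y : Xu → ℝ) :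
    (Sum.elim (fun _ => -t) y) ⬝ᵥ (Sum.elim (fun _ : Xl => -t) y) =
      (Fintype.card Xl : ℝ) * t ^ 2 + y ⬝ᵥ y := by
  simp only [dotProduct, Fintype.sum_sum_type, Sum.elim_inl, Sum.elim_inr, Finset.sum_const,
    Finset.card_univ, nsmul_eq_mul]
  ring

variable [DecidableEq Xl] [DecidableEq Xu] {V}

theorem norm2_Uflat_le {A : Matrix (Xl ⊕ Xu) (Xl ⊕ Xu) ℝ} {σ : Fin N → ℝ} (h : IsSpectral A σ V)
    (y : Xu → ℝ) : norm2 ((Uflat k V)ᵀ *ᵥ y) ≤ norm2 y := by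
  refine Real.sqrt_le_sqrt ?_
  have h1 := tailProj_quad_elim_const (Xl := Xl) k V 0 y
  rw [zero_smul, sub_zero] at h1
  have h2 := elim_const_dotProduct_self (Xl := Xl) 0 y
  rw [← h1, tailProj_quad]
  have h3 : y ⬝ᵥ y = (Sum.elim (fun _ => -0) y) ⬝ᵥ (Sum.elim (fun _ : Xl => -0) y) := by
    rw [h2]; simp
  rw [h3, h.parseval]
  refine Finset.sum_le_sum fun i _ => ?_
  split_ifs
  · exact le_rfl
  · exact sq_nonneg _

/-- A vector that linear functions of the features, whose range contains the top `k` eigenvectors,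
fit on the unlabeled points up to its component in the low eigenspaces. -/
theorem exists_fit {A : Matrix (Xl ⊕ Xu) (Xl ⊕ Xu) ℝ} {σ : Fin N → ℝ} (h : IsSpectral A σ V)
    {F : Matrix (Xl ⊕ Xu) (Fin k) ℝ}
    (hF : ∀ i : Fin N, (i : ℕ) < k → ∃ c, F *ᵥ c = V.col i) (w : Xl ⊕ Xu → ℝ) :
    ∃ m, ∑ x : Xu, (w (Sum.inr x) - (F *ᵥ m) (Sum.inr x)) ^ 2 ≤ w ⬝ᵥ tailProj k V *ᵥ w := by
  have hF' : ∀ i : Fin N, ∃ c, (i : ℕ) < k → F *ᵥ c = V.col i := by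
    intro i
    by_cases hi : (i : ℕ) < k
    · obtain ⟨c, hc⟩ := hF i hi
      exact ⟨c, fun _ => hc⟩
    · exact ⟨0, fun h => absurd h hi⟩
  choose c hc using hF'
  set P := tailProj k V with hP
  -- The high part of the expansion of `w`, pulled back through `F`; the residual is exactly `P w`.
  refine ⟨∑ i : Fin N, (if (i : ℕ) < k then (Vᵀ *ᵥ w) i else 0) • c i, ?_⟩
  have hfit : F *ᵥ (∑ i : Fin N, (if (i : ℕ) < k then (Vᵀ *ᵥ w) i else 0) • c i) =
      w - P *ᵥ w := by
    have h1 : Vᵀ *ᵥ (w - P *ᵥ w) = fun i : Fin N => if (i : ℕ) < k then (Vᵀ *ᵥ w) i else 0 := by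
      ext i
      rw [Matrix.mulVec_sub, Pi.sub_apply, hP, transpose_mulVec_tailProj k h.2.2.1]
      by_cases hi : k ≤ (i : ℕ)
      · rw [if_pos hi, if_neg (not_lt.2 hi), sub_self]
      · rw [if_neg hi, if_pos (not_le.1 hi), sub_zero]
    have h2 : w - P *ᵥ w = V *ᵥ (Vᵀ *ᵥ (w - P *ᵥ w)) := by
      rw [Matrix.mulVec_mulVec, h.mul_transpose, Matrix.one_mulVec]
    rw [h2, h1, Matrix.mulVec_sum]
    ext x
    rw [Finset.sum_apply, Matrix.mulVec, dotProduct]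
    refine Finset.sum_congr rfl fun i _ => ?_
    rw [Matrix.mulVec_smul, Pi.smul_apply, smul_eq_mul]
    split_ifs with hi
    · rw [hc i hi, Matrix.col_apply, mul_comm]
    · simp
  have hPw : w ⬝ᵥ P *ᵥ w = (P *ᵥ w) ⬝ᵥ (P *ᵥ w) := by
    rw [dotProduct_mulVec_comm_of_symm (tailProj_transpose k V), Matrix.mulVec_mulVec,
      tailProj_mul_self k h.2.2.1]
  rw [hfit, hPw]
  simp only [Pi.sub_apply, sub_sub_cancel]
  rw [dotProduct, Fintype.sum_sum_type]
  simp only [← sq]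
  exact le_add_of_nonneg_left (Finset.sum_nonneg fun i _ => sq_nonneg _)

end Tail

/-! ### From regression error to classification error. -/

section Probing

variable {Xu : Type*} [Fintype Xu] {c : ℕ}

theorem labelVec_dotProduct_self (label : Xu → Fin c) (i : Fin c) :
    labelVec label i ⬝ᵥ labelVec label i =
      ((Finset.univ.filter fun x => label x = i).card : ℝ) := by
  rw [Finset.card_filter, Nat.cast_sum]
  refine Finset.sum_congr rfl fun x _ => ?_
  simp only [labelVec]
  split_ifs <;> simp

/-- The number of errors of a linear classifier is bounded by its squared regression error, even
after a positive rescaling of the points. -/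
theorem probingError_le {Xl : Type*} {k : ℕ} {argmax : (Fin c → ℝ) → Fin c}
    (hargmax : ∀ (v : Fin c → ℝ) (i : Fin c), v i ≤ v (argmax v)) (label : Xu → Fin c)
    (f : Xl ⊕ Xu → Fin k → ℝ) (s : Xu → ℝ) (hs : ∀ x, 0 < s x) (m : Fin c → Fin k → ℝ) :
    (probingError argmax label f : ℝ) ≤
      2 * ∑ i, ∑ x, (labelVec label i x - s x * (f (Sum.inr x) ⬝ᵥ m i)) ^ 2 := by
  have h1 : probingError argmax label f ≤ _ :=
    ciInf_le (OrderBot.bddBelow _) (Matrix.of fun j i => m i j)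
  refine (Nat.cast_le.2 h1).trans ?_
  rw [Finset.sum_comm, Finset.mul_sum, Finset.card_filter, Nat.cast_sum]
  refine Finset.sum_le_sum fun x _ => ?_
  have hnn : ∀ i, 0 ≤ (labelVec label i x - s x * (f (Sum.inr x) ⬝ᵥ m i)) ^ 2 :=
    fun i => sq_nonneg _
  split_ifs with hx
  · set v : Fin c → ℝ := f (Sum.inr x) ᵥ* (Matrix.of fun j i => m i j) with hv
    have hvi : ∀ i, v i = f (Sum.inr x) ⬝ᵥ m i := fun i => rfl
    simp only [← hvi]
    have hle := mul_le_mul_of_nonneg_left (hargmax v (label x)) (hs x).le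
    have hsub := Finset.sum_le_sum_of_subset_of_nonneg
      (f := fun i => (labelVec label i x - s x * v i) ^ 2)
      (Finset.subset_univ {label x, argmax v}) fun i _ _ => sq_nonneg _
    rw [Finset.sum_pair hx] at hsub
    have e1 : labelVec label (label x) x = 1 := if_pos rfl
    have e2 : labelVec label (argmax v) x = 0 := if_neg hx
    rw [e1, e2] at hsub
    push_cast
    -- If the true label has rescaled score `p` and the prediction `q ≥ p`, then `(1 - p)² + q² ≥ (1
    -- - p + q)² / 2 ≥ 1/2`.
    nlinarith [sq_nonneg (1 - s x * v (label x) - s x * v (argmax v)),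
      sq_nonneg (s x * v (argmax v) + s x * v (label x) - 1)]
  · simpa using Finset.sum_nonneg fun i _ => hnn i

end Probing

/-! ### The bound on the probing error. -/

section ErrorBound

variable {Xl Xu Yl : Type*} [Fintype Xl] [Fintype Xu] [Fintype Yl]
  [DecidableEq Xl] [DecidableEq Xu] (D : Data Xl Xu Yl)

/-- Positive degrees allow every matrix `G` to be written as `weighted g`, so a minimizer of the
loss is a minimizer among all Gram matrices. -/
theorem Data.top_mem_range_weighted (hdeg : ∀ x, 0 < D.deg x) {k N : ℕ} (hk : 0 < k) (hkN : k < N)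
    (hk' : k - 1 < N)
    {σ : Fin N → ℝ} {V : Matrix (Xl ⊕ Xu) (Fin N) ℝ} (hV : IsSpectral D.normAdj σ V)
    (hgap : σ ⟨k, hkN⟩ < σ ⟨k - 1, hk'⟩) {f : Xl ⊕ Xu → Fin k → ℝ}
    (hf : ∀ g : Xl ⊕ Xu → Fin k → ℝ, D.nscl f ≤ D.nscl g) (i : Fin N) (hi : (i : ℕ) < k) :
    ∃ c, D.weighted f *ᵥ c = V.col i := by
  refine hV.top_mem_range_of_minimizer D.normAdj_transpose (hV.nonneg D.normAdj_quad_nonneg) hk hkN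
    hk' hgap (fun G => ?_) i hi
  have hG : D.weighted (fun x j => G x j / √(D.deg x)) = G := by
    ext x j
    have := Real.sqrt_pos.2 (hdeg x)
    rw [Data.weighted, Matrix.of_apply, mul_div_cancel₀ _ this.ne']
  have := hf fun x j => G x j / √(D.deg x)
  rw [D.nscl_eq _ hdeg, D.nscl_eq _ hdeg, hG] at this
  linarith

/-- The regression target is `y` extended by `-t` to the labeled points, with `t` the coefficient of
the projection of `(U^♭)ᵀ y` onto `lflat`. This choice produces `1 - κ²`, and `N_l t²` is the extra
perturbation cost. -/
theorem Data.exists_fit_le (hdeg : ∀ x, 0 < D.deg x) {k N : ℕ} (hk : 0 < k) (hkN : k < N)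
    (hk' : k - 1 < N)
    {σ : Fin N → ℝ} {V : Matrix (Xl ⊕ Xu) (Fin N) ℝ} (hV : IsSpectral D.normAdj σ V)
    {σbar : Fin N → ℝ} {Vbar : Matrix (Xl ⊕ Xu) (Fin N) ℝ}
    (hVbar : IsSpectral D.avgAdj σbar Vbar) {f : Xl ⊕ Xu → Fin k → ℝ}
    (hf : ∀ g : Xl ⊕ Xu → Fin k → ℝ, D.nscl f ≤ D.nscl g)
    (hgap : specNorm (D.normAdj - D.avgAdj) < 1 / 2 * (σ ⟨k - 1, hk'⟩ - σ ⟨k, hkN⟩))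
    (y : Xu → ℝ) :
    ∃ m, ∑ x : Xu, (y x - √(D.deg (Sum.inr x)) * (f (Sum.inr x) ⬝ᵥ m)) ^ 2 ≤
      norm2 y ^ 2 * (ignorance k Vbar y * (1 - coverage k Vbar y ^ 2) +
        2 * (1 + (Fintype.card Xl : ℝ) * coverage k Vbar y ^ 2 * ignorance k Vbar y ^ 2 /
          norm2 (lflat k Vbar) ^ 2) * (specNorm (D.normAdj - D.avgAdj) /
            (σ ⟨k - 1, hk'⟩ - σ ⟨k, hkN⟩))) := by
  set a := (Uflat k Vbar)ᵀ *ᵥ y with ha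
  set b := lflat k Vbar with hb
  set t := a ⬝ᵥ b / norm2 b ^ 2 with ht
  have h0 := specNorm_nonneg (D.normAdj - D.avgAdj)
  obtain ⟨m, hm⟩ := exists_fit k hV
    (D.top_mem_range_weighted hdeg hk hkN hk' hV (by linarith) hf) (Sum.elim (fun _ => -t) y)
  refine ⟨m, ?_⟩
  have hw : ∀ x, (D.weighted f *ᵥ m) x = √(D.deg x) * (f x ⬝ᵥ m) := by
    intro x
    simp only [Data.weighted, Matrix.mulVec, dotProduct, Matrix.of_apply, Finset.mul_sum, mul_assoc]
  simp only [hw, Sum.elim_inr] at hm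
  refine hm.trans ((hV.davisKahan hVbar hkN hk' hgap _).trans ?_)
  rw [tailProj_quad_elim_const, elim_const_dotProduct_self, ← ha, ← hb, dotProduct_sub_proj,
    ← norm2_sq]
  set ε := specNorm (D.normAdj - D.avgAdj) / (σ ⟨k - 1, hk'⟩ - σ ⟨k, hkN⟩) with hε
  have hε0 : 0 ≤ ε := div_nonneg h0 (by linarith)
  have hcov : coverage k Vbar y = cosine a b := rfl
  have hle : norm2 a ≤ norm2 y := norm2_Uflat_le k hVbar y
  have hT : norm2 a = norm2 y * ignorance k Vbar y := by
    rw [ignorance, ← ha]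
    rcases eq_or_ne (norm2 y) 0 with h | h
    · rw [h, zero_mul]
      exact le_antisymm (h ▸ hle) (norm2_nonneg a)
    · rw [mul_div_cancel₀ _ h]
  have hT0 : 0 ≤ ignorance k Vbar y := div_nonneg (norm2_nonneg _) (norm2_nonneg _)
  have hT1 : ignorance k Vbar y ≤ 1 := div_le_one_of_le₀ hle (norm2_nonneg _)
  have ht2 : t ^ 2 = norm2 y ^ 2 * (cosine a b ^ 2 * ignorance k Vbar y ^ 2 / norm2 b ^ 2) := by
    have := norm2_sq_mul_cosine_sq a b
    rw [hT, mul_pow] at this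
    rw [ht, div_pow, sq (norm2 b ^ 2), ← div_div, ← this]
    ring
  rw [ht2, hT, hcov]
  have hκ := cosine_sq_le_one a b
  set κ := cosine a b
  set T := ignorance k Vbar y
  -- The natural bound has `T²`; one factor `T ≤ 1` is given away.
  have h1 : (norm2 y * T) ^ 2 * (1 - κ ^ 2) ≤ norm2 y ^ 2 * (T * (1 - κ ^ 2)) := by
    have : T ^ 2 ≤ T := by nlinarith
    rw [mul_pow, mul_assoc]
    exact mul_le_mul_of_nonneg_left (mul_le_mul_of_nonneg_right this (by linarith)) (sq_nonneg _)
  refine (add_le_add_left h1 _).trans_eq ?_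
  ring

theorem Data.probingError_bound (hdeg : ∀ x, 0 < D.deg x) {k N : ℕ} (hk : 0 < k) (hkN : k < N)
    (hk' : k - 1 < N)
    {σ : Fin N → ℝ} {V : Matrix (Xl ⊕ Xu) (Fin N) ℝ} (hV : IsSpectral D.normAdj σ V)
    {σbar : Fin N → ℝ} {Vbar : Matrix (Xl ⊕ Xu) (Fin N) ℝ}
    (hVbar : IsSpectral D.avgAdj σbar Vbar) {c : ℕ} {argmax : (Fin c → ℝ) → Fin c}
    {label : Xu → Fin c} {f : Xl ⊕ Xu → Fin k → ℝ}
    (hargmax : ∀ (v : Fin c → ℝ) (i : Fin c), v i ≤ v (argmax v))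
    (hbal : ∀ i, (Finset.univ.filter fun x => label x = i).card * c = Fintype.card Xu)
    (hf : ∀ g : Xl ⊕ Xu → Fin k → ℝ, D.nscl f ≤ D.nscl g)
    (hgap : specNorm (D.normAdj - D.avgAdj) < 1 / 2 * (σ ⟨k - 1, hk'⟩ - σ ⟨k, hkN⟩)) :
    (probingError argmax label f : ℝ) ≤
      2 * (Fintype.card Xu : ℝ) / (c : ℝ) *
        (∑ i : Fin c, ignorance k Vbar (labelVec label i) *
            (1 - coverage k Vbar (labelVec label i) ^ 2)
          + (2 * ∑ i : Fin c, (1 + (Fintype.card Xl : ℝ) *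
                coverage k Vbar (labelVec label i) ^ 2 *
                ignorance k Vbar (labelVec label i) ^ 2 / norm2 (lflat k Vbar) ^ 2)) *
            (specNorm (D.normAdj - D.avgAdj) / (σ ⟨k - 1, hk'⟩ - σ ⟨k, hkN⟩))) := by
  choose m hm using fun i : Fin c =>
    D.exists_fit_le hdeg hk hkN hk' hV hVbar hf hgap (labelVec label i)
  refine (probingError_le hargmax label f _
    (fun x => Real.sqrt_pos.2 (hdeg (Sum.inr x))) m).trans ?_
  refine (mul_le_mul_of_nonneg_left (Finset.sum_le_sum fun i _ => hm i) zero_le_two).trans_eq ?_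
  have hnorm : ∀ i, norm2 (labelVec label i) ^ 2 = (Fintype.card Xu : ℝ) / c := by
    intro i
    have hc : (c : ℝ) ≠ 0 := by
      have := i.pos
      positivity
    rw [norm2_sq, labelVec_dotProduct_self, eq_div_iff hc]
    exact_mod_cast hbal i
  simp only [hnorm]
  rw [← Finset.mul_sum, Finset.sum_add_distrib, ← Finset.sum_mul, ← Finset.mul_sum]
  ring

end ErrorBound

/-! ### Scalar inequalities: reverse Cauchy-Schwarz and the secular equation. -/

/-- A weighted reverse Cauchy-Schwarz inequality (Kantorovich, Pólya-Szegő). -/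
theorem two_sqrt_mul_le_of_mem_Icc {ι : Type*} [Fintype ι] {p z : ι → ℝ} {a b : ℝ}
    (hp : ∀ i, 0 ≤ p i) (ha : 0 ≤ a) (hb : 0 ≤ b)
    (hz : ∀ i, p i ≠ 0 → a ≤ z i ∧ z i ≤ b) :
    2 * √(a * b) * (√(∑ i, p i * z i ^ 2) * √(∑ i, p i)) ≤ (a + b) * ∑ i, p i * z i := by
  -- This is the sum of `p i (z i - a)(b - z i) ≥ 0`; the arithmetic-geometric mean inequality
  -- finishes.
  have h1 : ∑ i, p i * z i ^ 2 + a * b * ∑ i, p i ≤ (a + b) * ∑ i, p i * z i := by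
    rw [Finset.mul_sum, Finset.mul_sum, ← Finset.sum_add_distrib]
    refine Finset.sum_le_sum fun i _ => ?_
    by_cases hi : p i = 0
    · simp [hi]
    · obtain ⟨h1, h2⟩ := hz i hi
      have := mul_nonneg (hp i) (mul_nonneg (sub_nonneg.2 h1) (sub_nonneg.2 h2))
      linarith
  have hX : 0 ≤ ∑ i, p i * z i ^ 2 :=
    Finset.sum_nonneg fun i _ => mul_nonneg (hp i) (sq_nonneg _)
  have hY : 0 ≤ ∑ i, p i := Finset.sum_nonneg fun i _ => hp i
  set X := ∑ i, p i * z i ^ 2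
  set Y := ∑ i, p i
  refine le_trans ?_ h1
  have h2 := two_mul_le_add_sq (√X) (√(a * b) * √Y)
  rw [mul_pow, Real.sq_sqrt hX, Real.sq_sqrt hY, Real.sq_sqrt (mul_nonneg ha hb)] at h2
  linarith

theorem norm2_sq_eq_sum {ι : Type*} [Fintype ι] (v : ι → ℝ) : norm2 v ^ 2 = ∑ j, v j ^ 2 := by
  rw [norm2_sq, dotProduct]
  exact Finset.sum_congr rfl fun j _ => (sq _).symm

theorem abs_apply_le_norm2 {ι : Type*} [Fintype ι] (v : ι → ℝ) (j : ι) : |v j| ≤ norm2 v := by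
  refine abs_le_of_sq_le_sq ?_ (norm2_nonneg v)
  rw [norm2_sq_eq_sum]
  exact Finset.single_le_sum (f := fun j => v j ^ 2) (fun j _ => sq_nonneg _) (Finset.mem_univ j)

theorem sum_abs_mul_abs_le {ι : Type*} [Fintype ι] (c e : ι → ℝ) :
    ∑ j, |c j| * |e j| ≤ norm2 c * norm2 e := by
  have h2 := (abs_le.1 (abs_dotProduct_le (fun j => |c j|) fun j => |e j|)).2
  have h3 : ∀ v : ι → ℝ, norm2 (fun j => |v j|) = norm2 v := by
    intro v
    simp [norm2, dotProduct]
  rwa [h3, h3] at h2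

/-- If `x` solves the secular equation `∑ⱼ eⱼ² / (dⱼ - x) = L - δ` with `L` large, then `x` lies
close below a pole `dₘ`, whose term dominates the sums `∑ⱼ cⱼ eⱼ / (dⱼ - x)`. -/
theorem secular_estimate {ι : Type*} [Fintype ι] [DecidableEq ι] {d e c : ι → ℝ} {m : ι}
    {x L δ g ε₁ ε₂ ε₃ r : ℝ} (hL : 0 < L) (hg : 0 < g) (hδ0 : 0 ≤ δ) (hδ : δ ≤ ε₁ * L)
    (hxm : x < d m) (hgap : ∀ j, j ≠ m → g ≤ |d j - d m|) (hbelow : ∀ j, d j < d m → d j < x)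
    (hsec : ∑ j, e j ^ 2 / (d j - x) = L - δ) (hr : r ≠ 0) (hcm : c m = r * e m)
    (h₂ : norm2 e ^ 2 ≤ ε₂ * L * g) (h₃ : norm2 c * norm2 e ≤ ε₃ * L * g * |r|)
    (hε : ε₁ + ε₂ + ε₃ < 1 / 2) :
    |∑ j, c j * e j / (d j - x) - r * L| ≤
      (ε₁ + ε₂ + ε₃) * (1 - (ε₁ + ε₂ + ε₃)) / (1 - 3 / 2 * (ε₁ + ε₂ + ε₃)) * (|r| * L) := by
  have hr0 : 0 < |r| := abs_pos.2 hr
  have hLg : 0 < L * g := mul_pos hL hg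
  have hε₁ : 0 ≤ ε₁ := by
    by_contra! h
    have := mul_neg_of_neg_of_pos h hL
    linarith
  have hε₂ : 0 ≤ ε₂ := by
    by_contra! h
    have := mul_neg_of_neg_of_pos h hLg
    linarith [sq_nonneg (norm2 e)]
  have hε₃ : 0 ≤ ε₃ := by
    by_contra! h
    have := mul_neg_of_neg_of_pos h (mul_pos hLg hr0)
    linarith [mul_nonneg (norm2_nonneg c) (norm2_nonneg e)]
  set ε := ε₁ + ε₂ + ε₃ with hεdef
  -- `g' = g - g ε / (2 (1 - ε))` is what remains of the gap when `x` is within `g ε / (2 (1 - ε))`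
  -- of `d m`: a lower bound for the distance from `x` to every other pole.
  set g' := g * ((1 - 3 / 2 * ε) / (1 - ε)) with hg'
  have h1ε : 0 < 1 - ε := by linarith
  have h2ε : 0 < 1 - 3 / 2 * ε := by linarith
  have hg'0 : 0 < g' := by positivity
  have hg'g : g' ≤ g := by
    have : (1 - 3 / 2 * ε) / (1 - ε) ≤ 1 := by
      rw [div_le_one h1ε]
      linarith
    exact mul_le_of_le_one_right hg.le this
  have habove : ∀ j, j ≠ m → d m ≤ d j → g ≤ d j - x := by
    intro j hj hle
    have := hgap j hj
    rw [abs_of_nonneg (by linarith)] at this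
    linarith
  -- `e m ^ 2` is bounded both through `ε₂` and, using `c m = r * e m`, through `ε₃`. Averaging the
  -- two bounds gains the factor `1/2` in the estimate of `d m - x`.
  have hem₂ : e m ^ 2 ≤ ε₂ * L * g := by
    refine le_trans ?_ h₂
    rw [norm2_sq_eq_sum]
    exact Finset.single_le_sum (f := fun j => e j ^ 2) (fun j _ => sq_nonneg _) (Finset.mem_univ m)
  have hem₃ : e m ^ 2 ≤ ε₃ * L * g := by
    have h1 : |c m| * |e m| ≤ norm2 c * norm2 e :=
      mul_le_mul (abs_apply_le_norm2 c m) (abs_apply_le_norm2 e m) (abs_nonneg _) (norm2_nonneg c)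
    rw [hcm, abs_mul, mul_assoc, ← sq, sq_abs] at h1
    have h2 : e m ^ 2 * |r| ≤ ε₃ * L * g * |r| := by linarith
    exact le_of_mul_le_mul_right h2 hr0
  set T := e m ^ 2 / (d m - x) with hT
  set E := ∑ j ∈ Finset.univ.erase m, e j ^ 2 / (d j - x) with hE
  set H := ∑ j ∈ Finset.univ.erase m, c j * e j / (d j - x) with hH
  have hTE : T + E = L - δ := by
    rw [← hsec]
    exact Finset.add_sum_erase _ (fun j => e j ^ 2 / (d j - x)) (Finset.mem_univ m)
  have hTH : r * T + H = ∑ j, c j * e j / (d j - x) := by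
    rw [← Finset.add_sum_erase _ (fun j => c j * e j / (d j - x)) (Finset.mem_univ m), hcm, hT]
    ring
  have hErase : ∀ v : ι → ℝ, (∀ j, 0 ≤ v j) → ∑ j ∈ Finset.univ.erase m, v j ≤ ∑ j, v j :=
    fun v hv => Finset.sum_le_sum_of_subset_of_nonneg (Finset.erase_subset _ _) fun j _ _ => hv j
  -- For an upper bound, poles below `x` may be dropped since their terms are nonpositive; those
  -- above are at distance at least `g`.
  have hElow : E ≤ ε₂ * L := by
    have h1 : E ≤ ∑ j ∈ Finset.univ.erase m, e j ^ 2 / g := by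
      refine Finset.sum_le_sum fun j hj => ?_
      rcases lt_or_ge (d j) (d m) with h | h
      · have := hbelow j h
        exact (div_nonpos_of_nonneg_of_nonpos (sq_nonneg _) (by linarith)).trans (by positivity)
      · exact div_le_div_of_nonneg_left (sq_nonneg _) hg
          (habove j (Finset.ne_of_mem_erase hj) h)
    refine h1.trans ((hErase _ fun j => by positivity).trans ?_)
    rw [← Finset.sum_div, ← norm2_sq_eq_sum, div_le_iff₀ hg]
    exact h₂
  have hTge : L * (1 - ε) ≤ T := by linarith [mul_nonneg hε₃ hL.le]
  have hdm : d m - x ≤ g * (ε / 2 / (1 - ε)) := by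
    have h1 : T * (d m - x) = e m ^ 2 := div_mul_cancel₀ _ (by linarith)
    have h2 : L * (1 - ε) * (d m - x) ≤ e m ^ 2 := by
      rw [← h1]
      exact mul_le_mul_of_nonneg_right hTge (by linarith)
    have h3 : e m ^ 2 ≤ L * (g * (ε / 2)) := by linarith [mul_nonneg hε₁ hLg.le]
    have h4 : (1 - ε) * (d m - x) ≤ g * (ε / 2) := by
      refine le_of_mul_le_mul_left ?_ hL
      linarith
    rw [← mul_div_assoc, le_div_iff₀ h1ε]
    linarith
  have hfar : ∀ j, j ≠ m → g' ≤ |d j - x| := by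
    intro j hj
    rcases lt_or_ge (d j) (d m) with h | h
    · have h1 := hbelow j h
      have h2 := hgap j hj
      rw [abs_of_neg (by linarith)] at h2 ⊢
      have : g' = g - g * (ε / 2 / (1 - ε)) := by
        rw [hg']
        field_simp
        ring
      linarith
    · exact hg'g.trans ((habove j hj h).trans (le_abs_self _))
  have hEabs : |E| ≤ ε₂ * L * g / g' := by
    have h1 : |E| ≤ ∑ j ∈ Finset.univ.erase m, e j ^ 2 / g' := by
      refine (Finset.abs_sum_le_sum_abs _ _).trans (Finset.sum_le_sum fun j hj => ?_)
      rw [abs_div, abs_of_nonneg (sq_nonneg (e j))]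
      exact div_le_div_of_nonneg_left (sq_nonneg _) hg'0 (hfar j (Finset.ne_of_mem_erase hj))
    refine h1.trans ((hErase _ fun j => by positivity).trans ?_)
    rw [← Finset.sum_div, ← norm2_sq_eq_sum]
    exact div_le_div_of_nonneg_right h₂ hg'0.le
  have hHabs : |H| ≤ ε₃ * L * g * |r| / g' := by
    have h1 : |H| ≤ ∑ j ∈ Finset.univ.erase m, |c j| * |e j| / g' := by
      refine (Finset.abs_sum_le_sum_abs _ _).trans (Finset.sum_le_sum fun j hj => ?_)
      rw [abs_div, abs_mul]
      exact div_le_div_of_nonneg_left (by positivity) hg'0 (hfar j (Finset.ne_of_mem_erase hj))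
    refine h1.trans ((hErase _ fun j => by positivity).trans ?_)
    rw [← Finset.sum_div]
    refine div_le_div_of_nonneg_right (le_trans ?_ h₃) hg'0.le
    exact sum_abs_mul_abs_le c e
  have hgg : g / g' = (1 - ε) / (1 - 3 / 2 * ε) := by
    rw [hg']
    field_simp
  have hgg1 : 1 ≤ g / g' := (one_le_div hg'0).2 hg'g
  -- The dominant term `r T` is eliminated by the secular equation `T + E = L - δ`, leaving one
  -- error for each `ε`.
  have hkey : ∑ j, c j * e j / (d j - x) - r * L = -(r * δ) - r * E + H := by
    rw [← hTH, show T = L - δ - E by linarith]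
    ring
  rw [hkey]
  have t1 : |-(r * δ) - r * E + H| ≤ |r| * δ + |r| * |E| + |H| := by
    refine (abs_add_le _ _).trans (add_le_add ((abs_sub _ _).trans ?_) le_rfl)
    rw [abs_neg, abs_mul, abs_mul, abs_of_nonneg hδ0]
  refine t1.trans ?_
  have t2 : |r| * δ ≤ |r| * (ε₁ * L) * (g / g') := by
    have : |r| * δ ≤ |r| * (ε₁ * L) := mul_le_mul_of_nonneg_left hδ hr0.le
    exact this.trans (le_mul_of_one_le_right (by positivity) hgg1)
  have t3 : |r| * |E| ≤ |r| * (ε₂ * L * g / g') := mul_le_mul_of_nonneg_left hEabs hr0.le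
  calc _ ≤ |r| * (ε₁ * L) * (g / g') + |r| * (ε₂ * L * g / g') + ε₃ * L * g * |r| / g' := by
        linarith
    _ = ε * (g / g') * (|r| * L) := by rw [hεdef]; ring
    _ = _ := by rw [hgg, mul_div_assoc]

/-- The numerical comparison behind the lower bound on the coverage. -/
theorem one_sub_two_mul_le_sqrt {ε γ a b : ℝ} (h0 : 0 ≤ ε) (h1 : ε < 1 / 2)
    (hγ : γ = ε * (1 - ε) / (1 - 3 / 2 * ε)) (ha : 0 < a) (hab : a ≤ b) :
    0 < 1 - γ ∧ 0 ≤ γ ∧ (1 - 2 * ε) * (2 * √(a * b) / (a + b)) ≤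
      2 * √((1 - γ) * a * ((1 + γ) * b)) / ((1 - γ) * a + (1 + γ) * b) := by
  have hD : 0 < 1 - 3 / 2 * ε := by linarith
  have hγD : γ * (1 - 3 / 2 * ε) = ε * (1 - ε) := by rw [hγ, div_mul_cancel₀ _ hD.ne']
  have hγ0 : 0 ≤ γ := by
    rw [hγ]
    exact div_nonneg (mul_nonneg h0 (by linarith)) hD.le
  have hγ1 : 0 < 1 - γ := by
    have : 0 < (1 - γ) * (1 - 3 / 2 * ε) := by nlinarith
    exact pos_of_mul_pos_left this hD.le
  have hq : (1 - 2 * ε) ^ 2 * (1 + γ) ≤ 1 - γ := by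
    refine le_of_mul_le_mul_right ?_ hD
    have e1 : (1 - γ) * (1 - 3 / 2 * ε) = 1 - 3 / 2 * ε - ε * (1 - ε) := by rw [← hγD]; ring
    have e2 : (1 - 2 * ε) ^ 2 * (1 + γ) * (1 - 3 / 2 * ε) =
        (1 - 2 * ε) ^ 2 * (1 - 3 / 2 * ε + ε * (1 - ε)) := by rw [← hγD]; ring
    rw [e1, e2]
    -- This is exactly the difference of the two sides once the denominator of `γ` is cleared.
    have : 0 ≤ 2 * ε * (1 - 2 * ε) * (1 - ε ^ 2) :=
      mul_nonneg (mul_nonneg (by linarith) (by linarith)) (by nlinarith)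
    nlinarith
  refine ⟨hγ1, hγ0, ?_⟩
  have hb : 0 < b := ha.trans_le hab
  have hs : (1 - 2 * ε) * (1 + γ) ≤ √((1 - γ) * (1 + γ)) := by
    refine Real.le_sqrt_of_sq_le ?_
    nlinarith
  have hsplit : √((1 - γ) * a * ((1 + γ) * b)) = √((1 - γ) * (1 + γ)) * √(a * b) := by
    rw [← Real.sqrt_mul (by positivity)]
    congr 1
    ring
  rw [hsplit, ← mul_div_assoc, div_le_div_iff₀ (by positivity) (by positivity)]
  have hS := Real.sqrt_nonneg (a * b)
  have hden : (1 - γ) * a + (1 + γ) * b ≤ (1 + γ) * (a + b) := by nlinarith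
  calc (1 - 2 * ε) * (2 * √(a * b)) * ((1 - γ) * a + (1 + γ) * b)
      ≤ (1 - 2 * ε) * (2 * √(a * b)) * ((1 + γ) * (a + b)) :=
        mul_le_mul_of_nonneg_left hden (mul_nonneg (by linarith) (by positivity))
    _ = ((1 - 2 * ε) * (1 + γ)) * (2 * √(a * b) * (a + b)) := by ring
    _ ≤ √((1 - γ) * (1 + γ)) * (2 * √(a * b) * (a + b)) :=
        mul_le_mul_of_nonneg_right hs (by positivity)
    _ = _ := by ring

/-! ### Eigenvalues and eigenvectors of the averaged matrix. -/

section Coverage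

theorem coord_eq {Xu : Type*} [Fintype Xu] {Nu : ℕ} (Q : Matrix Xu (Fin Nu) ℝ) (y : Xu → ℝ)
    (j : Fin Nu) : coord Q y j = (Qᵀ *ᵥ y) j :=
  dotProduct_comm _ _

theorem omega_eq {Xu : Type*} [Fintype Xu] {Nu : ℕ} (d : Fin Nu → ℝ) (Q : Matrix Xu (Fin Nu) ℝ)
    (y η : Xu → ℝ) (x : ℝ) :
    omega d Q y η x = -∑ j, coord Q y j * coord Q η j / (d j - x) := by
  rw [omega, dotProduct_mulVec_diagonal, ← Finset.sum_neg_distrib]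
  refine Finset.sum_congr rfl fun j _ => ?_
  rw [coord_eq, coord_eq, ← neg_sub (d j) x, inv_neg]
  ring

theorem norm2_coord {Xu : Type*} [Fintype Xu] [DecidableEq Xu] {Nu : ℕ} {Q : Matrix Xu (Fin Nu) ℝ}
    (hQ : Q * Qᵀ = 1) (y : Xu → ℝ) : norm2 (coord Q y) = norm2 y := by
  have : coord Q y = Qᵀ *ᵥ y := funext (coord_eq Q y)
  rw [norm2, this, dotProduct_transpose_mulVec_mulVec hQ, norm2]

theorem lflat_apply {Xl Xu : Type*} [Fintype Xl] {k N : ℕ} (Vbar : Matrix (Xl ⊕ Xu) (Fin N) ℝ)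
    (i : {i : Fin N // k ≤ (i : ℕ)}) :
    lflat k Vbar i = ∑ b, Vbar (Sum.inl b) i.1 := by
  simp [lflat, Lflat, Matrix.mulVec, dotProduct]

theorem Uflat_mulVec_apply {Xl Xu : Type*} [Fintype Xu] {k N : ℕ} (Vbar : Matrix (Xl ⊕ Xu) (Fin N) ℝ)
    (y : Xu → ℝ) (i : {i : Fin N // k ≤ (i : ℕ)}) :
    ((Uflat k Vbar)ᵀ *ᵥ y) i = ∑ x, Vbar (Sum.inr x) i.1 * y x := rfl

variable {Xl Xu Yl : Type*} [Fintype Xl] [Fintype Xu] [Fintype Yl]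
  [DecidableEq Xl] [DecidableEq Xu] [Nonempty Xl] (D : Data Xl Xu Yl)
  {k N : ℕ} {σbar : Fin N → ℝ} {Vbar : Matrix (Xl ⊕ Xu) (Fin N) ℝ}
  {Nu : ℕ} {d : Fin Nu → ℝ} {Q : Matrix Xu (Fin Nu) ℝ}

/-- The polynomial `η_l t² + 2 p t + q` is nonnegative for all `t`; if `η_l` were `0`, a nonzero `p`
would let it reach `-1`. -/
theorem Data.etaL_pos {u : Xu → ℝ} (hu : ∑ x, D.etaU x * u x ≠ 0) : 0 < D.etaL := by
  have h0 : 0 ≤ D.etaL := by simpa using D.averaged_quad_nonneg 1 0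
  refine lt_of_le_of_ne h0 fun h => ?_
  set p := ∑ x, D.etaU x * u x with hp
  set q := u ⬝ᵥ D.Auu *ᵥ u with hq
  have := D.averaged_quad_nonneg (-(q + 1) / (2 * p)) u
  rw [← h, ← hp, ← hq] at this
  have e : 2 * (-(q + 1) / (2 * p)) * p = -(q + 1) := by
    field_simp
  linarith

/-- The eigenvalues of the averaged matrix beyond the first `k` are at most `d_k`. -/
theorem Data.sigma_le (hVbar : IsSpectral D.avgAdj σbar Vbar) (hd : IsSpectral D.Auu d Q)
    (hk : 0 < k) (hk' : k - 1 < Nu) (i : Fin N) (hi : k ≤ (i : ℕ)) :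
    σbar i ≤ d ⟨k - 1, hk'⟩ := by
  have hkN : k < N := hi.trans_lt i.2
  -- One constraint on the labeled sum, which reduces the form to `Auu`, and `k - 1` on the leading
  -- eigencoordinates of `Auu`: `k` in all.
  let φ : (Xl ⊕ Xu → ℝ) →ₗ[ℝ] ℝ × (Fin (k - 1) → ℝ) :=
    LinearMap.prod ((Fintype.linearCombination ℝ fun _ : Xl => (1 : ℝ)).comp
        (LinearMap.funLeft ℝ ℝ Sum.inl))
      ((LinearMap.funLeft ℝ ℝ (Fin.castLE (by omega : k - 1 ≤ Nu))).comp
        (Qᵀ.mulVecLin.comp (LinearMap.funLeft ℝ ℝ Sum.inr)))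
  obtain ⟨v, hv0, hv, hle⟩ := hVbar.exists_constrained ⟨k, hkN⟩ (E := ℝ × (Fin (k - 1) → ℝ))
    (by simp; omega) φ
  obtain ⟨h1, h2⟩ := Prod.mk_eq_zero.1 hv
  have h1' : ∑ b : Xl, v (Sum.inl b) = 0 := by
    simpa [Fintype.linearCombination_apply, LinearMap.funLeft_apply] using h1
  have h2' : ∀ j : Fin Nu, (j : ℕ) < k - 1 → (Qᵀ *ᵥ fun x => v (Sum.inr x)) j = 0 :=
    fun j hj => congrFun h2 ⟨j, hj⟩
  have hd0 : ∀ j, 0 ≤ d j := hd.nonneg D.Auu_quad_nonneg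
  rw [D.avgAdj_quad, h1'] at hle
  have h3 : (fun x => v (Sum.inr x)) ⬝ᵥ D.Auu *ᵥ (fun x => v (Sum.inr x)) ≤
      d ⟨k - 1, hk'⟩ * ((fun x => v (Sum.inr x)) ⬝ᵥ fun x => v (Sum.inr x)) := by
    rw [hd.quad, hd.parseval, Finset.mul_sum]
    refine Finset.sum_le_sum fun j _ => ?_
    by_cases hj : (j : ℕ) < k - 1
    · simp [h2' j hj]
    · exact mul_le_mul_of_nonneg_right
        (hd.2.1 (show (⟨k - 1, hk'⟩ : Fin Nu) ≤ j from Fin.le_def.2 (not_lt.1 hj)))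
        (sq_nonneg _)
  have h4 : ((fun x => v (Sum.inr x)) ⬝ᵥ fun x => v (Sum.inr x)) ≤ v ⬝ᵥ v := by
    simp only [dotProduct, Fintype.sum_sum_type]
    exact le_add_of_nonneg_left (Finset.sum_nonneg fun b _ => mul_self_nonneg _)
  have h5 : 0 < v ⬝ᵥ v := by
    rw [← norm2_sq]
    exact pow_pos (norm2_pos hv0) 2
  have h6 : σbar ⟨k, hkN⟩ * (v ⬝ᵥ v) ≤ d ⟨k - 1, hk'⟩ * (v ⬝ᵥ v) := by
    have := mul_le_mul_of_nonneg_left h4 (hd0 ⟨k - 1, hk'⟩)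
    linarith
  exact (hVbar.2.1 (show (⟨k, hkN⟩ : Fin N) ≤ i from hi)).trans (le_of_mul_le_mul_right h6 h5)

/-- The eigenvalue equation of the averaged matrix in the eigenbasis of `A_uu`. -/
theorem Data.avgAdj_eigen (hVbar : IsSpectral D.avgAdj σbar Vbar) (hd : IsSpectral D.Auu d Q)
    (i : Fin N) :
    (∀ b, D.etaL * ∑ b, Vbar (Sum.inl b) i +
        ∑ j, coord Q D.etaU j * coord Q (fun x => Vbar (Sum.inr x) i) j =
      σbar i * Vbar (Sum.inl b) i) ∧
    ∀ j, (σbar i - d j) * coord Q (fun x => Vbar (Sum.inr x) i) j =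
      (∑ b, Vbar (Sum.inl b) i) * coord Q D.etaU j := by
  have hv := hVbar.apply i
  have hη : ∑ j, coord Q D.etaU j * coord Q (fun x => Vbar (Sum.inr x) i) j =
      ∑ x, D.etaU x * Vbar (Sum.inr x) i := by
    simp only [coord_eq]
    exact dotProduct_transpose_mulVec_mulVec hd.mul_transpose _ _
  constructor
  · intro b
    rw [hη]
    have := congrFun hv (Sum.inl b)
    rwa [D.avgAdj_mulVec_inl] at this
  · intro j
    have h1 : (∑ b, Vbar (Sum.inl b) i) • D.etaU + D.Auu *ᵥ (fun x => Vbar (Sum.inr x) i) =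
        σbar i • fun x => Vbar (Sum.inr x) i := by
      ext x
      have := congrFun hv (Sum.inr x)
      rwa [D.avgAdj_mulVec_inr] at this
    have h2 := congrFun (congrArg (Qᵀ *ᵥ ·) h1) j
    simp only [Matrix.mulVec_add, Matrix.mulVec_smul, Pi.add_apply, Pi.smul_apply, smul_eq_mul,
      hd.transpose_mulVec_mulVec] at h2
    rw [coord_eq, coord_eq]
    linarith

theorem Data.sum_avgAdj_eigen (hVbar : IsSpectral D.avgAdj σbar Vbar) (hd : IsSpectral D.Auu d Q)
    (i : Fin N) :
    (Fintype.card Xl : ℝ) * (D.etaL * ∑ b, Vbar (Sum.inl b) i +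
        ∑ j, coord Q D.etaU j * coord Q (fun x => Vbar (Sum.inr x) i) j) =
      σbar i * ∑ b, Vbar (Sum.inl b) i := by
  have h : σbar i * ∑ b, Vbar (Sum.inl b) i = ∑ _b : Xl, (D.etaL * ∑ b, Vbar (Sum.inl b) i +
      ∑ j, coord Q D.etaU j * coord Q (fun x => Vbar (Sum.inr x) i) j) := by
    rw [Finset.mul_sum]
    exact Finset.sum_congr rfl fun b _ => ((D.avgAdj_eigen hVbar hd i).1 b).symm
  rw [h, Finset.sum_const, Finset.card_univ, nsmul_eq_mul]

/-- Beyond the first `k` columns, an eigenvector that is orthogonal to the averaged labeled point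
vanishes on the unlabeled points. -/
theorem Data.unlabeled_eq_zero (hVbar : IsSpectral D.avgAdj σbar Vbar) (hd : IsSpectral D.Auu d Q)
    (hk : 0 < k) (hk' : k - 1 < Nu) (hη : ∀ j : Fin Nu, k ≤ (j : ℕ) + 1 → coord Q D.etaU j ≠ 0)
    (hne : ∀ i j : Fin Nu, k ≤ (i : ℕ) + 1 → i ≠ j → d i ≠ d j) (i : Fin N) (hi : k ≤ (i : ℕ))
    (hl : ∑ b, Vbar (Sum.inl b) i = 0) (x : Xu) : Vbar (Sum.inr x) i = 0 := by
  obtain ⟨-, h2⟩ := D.avgAdj_eigen hVbar hd i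
  have h1 := D.sum_avgAdj_eigen hVbar hd i
  have hle := D.sigma_le hVbar hd hk hk' i hi
  set c := coord Q fun x => Vbar (Sum.inr x) i with hc
  have hN : (Fintype.card Xl : ℝ) ≠ 0 := by simp
  rw [hl, mul_zero, mul_zero, zero_add, mul_eq_zero, or_iff_right hN] at h1
  rw [hl] at h2
  -- A nonzero coordinate `j` would force `σbar i = d j`. By interlacing `j` lies in the range where
  -- eigenvalues are simple, so `c` is supported at `j`, and its orthogonality to `η_u` contradicts
  -- `hη`.
  have hc0 : c = 0 := by
    by_contra h
    obtain ⟨j, hj⟩ := Function.ne_iff.1 h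
    rw [Pi.zero_apply] at hj
    have hxj : σbar i = d j := by
      have := h2 j
      rw [zero_mul, mul_eq_zero, or_iff_left hj] at this
      linarith
    have hjk : k ≤ (j : ℕ) + 1 := by
      by_contra! hjk
      have hle' : d ⟨k - 1, hk'⟩ ≤ d j := hd.2.1 (Fin.le_def.2 (by simp; omega))
      refine hne ⟨k - 1, hk'⟩ j (by simp; omega) ?_ (le_antisymm hle' (hxj ▸ hle))
      intro h
      have := congrArg Fin.val h
      simp at this
      omega
    have hother : ∀ j', j' ≠ j → c j' = 0 := by
      intro j' hj'
      have := h2 j'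
      rw [zero_mul, mul_eq_zero] at this
      refine this.resolve_left fun h => hne j j' hjk hj'.symm ?_
      linarith
    rw [Finset.sum_eq_single j (fun j' _ hj' => by rw [hother j' hj', mul_zero]) (by simp)] at h1
    exact (mul_ne_zero (hη j hjk) hj) h1
  have hz : (fun x => Vbar (Sum.inr x) i) = 0 := by
    have h3 : Qᵀ *ᵥ (fun x => Vbar (Sum.inr x) i) = 0 := by
      ext j
      rw [← coord_eq]
      exact congrFun hc0 j
    by_contra h
    exact transpose_mulVec_ne_zero hd.mul_transpose h h3
  exact congrFun hz x

/-- At a pole `d j` the eigenvalue equation makes the coordinate `j` of `η_u` vanish, so `j`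
precedes `k`. Interlacing then gives `d j = d_k`, against simplicity of `d_k`. -/
theorem Data.sigma_ne (hVbar : IsSpectral D.avgAdj σbar Vbar) (hd : IsSpectral D.Auu d Q)
    (hk : 0 < k) (hk' : k - 1 < Nu) (hη : ∀ j : Fin Nu, k ≤ (j : ℕ) + 1 → coord Q D.etaU j ≠ 0)
    (hne : ∀ i j : Fin Nu, k ≤ (i : ℕ) + 1 → i ≠ j → d i ≠ d j) (i : Fin N) (hi : k ≤ (i : ℕ))
    (hl : ∑ b, Vbar (Sum.inl b) i ≠ 0) (j : Fin Nu) : σbar i ≠ d j := by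
  intro hxj
  have h2 := (D.avgAdj_eigen hVbar hd i).2 j
  have hle := D.sigma_le hVbar hd hk hk' i hi
  rw [hxj, sub_self, zero_mul, eq_comm, mul_eq_zero, or_iff_right hl] at h2
  have hjk : (j : ℕ) + 1 < k := by
    by_contra! h
    exact hη j h h2
  have hle' : d ⟨k - 1, hk'⟩ ≤ d j := hd.2.1 (Fin.le_def.2 (by simp; omega))
  refine hne ⟨k - 1, hk'⟩ j (by simp; omega) ?_ (le_antisymm hle' (hxj ▸ hle))
  intro h
  have := congrArg Fin.val h
  simp at this
  omega

/-- The secular equation of the averaged matrix, and the unlabeled part of its eigenvectors. -/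
theorem Data.secular (hVbar : IsSpectral D.avgAdj σbar Vbar) (hd : IsSpectral D.Auu d Q)
    (i : Fin N) (hl : ∑ b, Vbar (Sum.inl b) i ≠ 0) (hne : ∀ j, σbar i ≠ d j) (y : Xu → ℝ) :
    ∑ j, coord Q D.etaU j ^ 2 / (d j - σbar i) = D.etaL - σbar i / (Fintype.card Xl : ℝ) ∧
      ∑ x, Vbar (Sum.inr x) i * y x =
        (∑ b, Vbar (Sum.inl b) i) * omega d Q y D.etaU (σbar i) := by
  have h1 := D.sum_avgAdj_eigen hVbar hd i
  have h2 := (D.avgAdj_eigen hVbar hd i).2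
  set l := ∑ b, Vbar (Sum.inl b) i with hldef
  have hc : ∀ j, coord Q (fun x => Vbar (Sum.inr x) i) j =
      -(l * (coord Q D.etaU j / (d j - σbar i))) := by
    intro j
    have h3 : d j - σbar i ≠ 0 := sub_ne_zero.2 (hne j).symm
    have := h2 j
    field_simp
    linarith
  have hN : (Fintype.card Xl : ℝ) ≠ 0 := by simp
  constructor
  · have h3 : ∑ j, coord Q D.etaU j * coord Q (fun x => Vbar (Sum.inr x) i) j =
        -(l * ∑ j, coord Q D.etaU j ^ 2 / (d j - σbar i)) := by
      rw [Finset.mul_sum, ← Finset.sum_neg_distrib]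
      refine Finset.sum_congr rfl fun j _ => ?_
      rw [hc]
      ring
    rw [h3] at h1
    have h4 : l * ((Fintype.card Xl : ℝ) *
        (D.etaL - ∑ j, coord Q D.etaU j ^ 2 / (d j - σbar i))) = l * σbar i := by
      linarith
    have h5 := mul_left_cancel₀ hl h4
    have h6 : σbar i / (Fintype.card Xl : ℝ) =
        D.etaL - ∑ j, coord Q D.etaU j ^ 2 / (d j - σbar i) := by
      rw [div_eq_iff hN]
      linarith
    linarith
  · have h3 : ∑ x, Vbar (Sum.inr x) i * y x =
        ∑ j, coord Q (fun x => Vbar (Sum.inr x) i) j * coord Q y j := by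
      simp only [coord_eq]
      exact (dotProduct_transpose_mulVec_mulVec hd.mul_transpose _ _).symm
    rw [h3, omega_eq, mul_neg, Finset.mul_sum, ← Finset.sum_neg_distrib]
    refine Finset.sum_congr rfl fun j _ => ?_
    rw [hc]
    ring

/-- Dimension count: some eigenvector beyond the first `k` sees the averaged labeled point. -/
theorem lflat_ne_zero {A : Matrix (Xl ⊕ Xu) (Xl ⊕ Xu) ℝ}
    (hVbar : IsSpectral A σbar Vbar) (hkN : k < N) (hNu : k ≤ Fintype.card Xu)
    (hU : ∀ i : Fin N, k ≤ (i : ℕ) → ∑ b, Vbar (Sum.inl b) i = 0 →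
      ∀ x, Vbar (Sum.inr x) i = 0) :
    lflat k Vbar ≠ 0 := by
  intro h0
  have hl : ∀ i : Fin N, k ≤ (i : ℕ) → ∑ b, Vbar (Sum.inl b) i = 0 := fun i hi => by
    have := congrFun h0 ⟨i, hi⟩
    rwa [lflat_apply] at this
  have hN : (0 : ℝ) < Fintype.card Xl := by exact_mod_cast Fintype.card_pos
  have hVV := hVbar.mul_transpose
  -- `g i` is the squared length of the projection of column `i` to the vectors constant on the
  -- labeled points, a space of dimension `N_u + 1`. If `lflat` vanished, only the first `k ≤ N_u`
  -- columns would contribute, each at most `1`.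
  set g : Fin N → ℝ := fun i => (∑ b, Vbar (Sum.inl b) i) ^ 2 / (Fintype.card Xl : ℝ) +
    ∑ x, Vbar (Sum.inr x) i ^ 2 with hg
  have hrow : ∀ p q, ∑ i, Vbar p i * Vbar q i = if p = q then 1 else 0 := by
    intro p q
    have := congrFun (congrFun hVV p) q
    rwa [Matrix.mul_apply, Matrix.one_apply] at this
  have hsum : ∑ i, g i = 1 + Fintype.card Xu := by
    simp only [hg, Finset.sum_add_distrib, ← Finset.sum_div]
    congr 1
    · have : ∑ i, (∑ b, Vbar (Sum.inl b) i) ^ 2 =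
          ∑ b : Xl, ∑ b' : Xl, ∑ i, Vbar (Sum.inl b) i * Vbar (Sum.inl b') i := by
        simp only [sq, Finset.sum_mul_sum]
        rw [Finset.sum_comm]
        refine Finset.sum_congr rfl fun b _ => ?_
        rw [Finset.sum_comm]
      rw [this]
      simp only [hrow, Sum.inl.injEq]
      simp
    · rw [Finset.sum_comm]
      simp [sq, hrow]
  have hle : ∀ i, g i ≤ if (i : ℕ) < k then 1 else 0 := by
    intro i
    split_ifs with hi
    · have h1 := hVbar.col_dotProduct_self i
      rw [dotProduct, Fintype.sum_sum_type] at h1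
      have h2 : (∑ b, Vbar (Sum.inl b) i) ^ 2 / (Fintype.card Xl : ℝ) ≤
          ∑ b, Vbar (Sum.inl b) i ^ 2 := by
        rw [div_le_iff₀ hN, mul_comm]
        simpa using sq_sum_le_card_mul_sum_sq (s := Finset.univ) (f := fun b => Vbar (Sum.inl b) i)
      simp only [Matrix.col_apply, ← sq] at h1
      simp only [hg]
      linarith
    · have hi' := not_lt.1 hi
      simp [hg, hl i hi', hU i hi' (hl i hi')]
  have h1 : ∑ i, g i ≤ k := by
    refine (Finset.sum_le_sum fun i _ => hle i).trans_eq ?_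
    rw [← sum_castLE hkN.le fun _ => 1]
    simp
  rw [hsum] at h1
  have h2 : (k : ℝ) ≤ Fintype.card Xu := by exact_mod_cast hNu
  linarith

/-- Each `ω_i` is close to `-η_l r_m` for some `m`. -/
theorem Data.omega_estimate (hVbar : IsSpectral D.avgAdj σbar Vbar) (hd : IsSpectral D.Auu d Q)
    (hk : 0 < k) (hk' : k - 1 < Nu) {y : Xu → ℝ} {gap R : ℝ} (hgap0 : 0 < gap)
    (hη : ∀ j : Fin Nu, k ≤ (j : ℕ) + 1 → coord Q D.etaU j ≠ 0)
    (hgap : ∀ i j : Fin Nu, k ≤ (i : ℕ) + 1 → i ≠ j → gap ≤ |d i - d j|)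
    (hR0 : 0 < R) (hR : ∀ j : Fin Nu, k ≤ (j : ℕ) + 1 → R ≤ |ratio Q y D.etaU j|) {ε : ℝ}
    (hε : ε = d ⟨k - 1, hk'⟩ / ((Fintype.card Xl : ℝ) * D.etaL)
            + norm2 D.etaU ^ 2 / (D.etaL * gap)
            + norm2 y * norm2 D.etaU / (D.etaL * gap * R)) (hε2 : ε < 1 / 2) (hL : 0 < D.etaL)
    (i : Fin N) (hi : k ≤ (i : ℕ)) (hl : ∑ b, Vbar (Sum.inl b) i ≠ 0) :
    ∃ m : Fin Nu, k ≤ (m : ℕ) + 1 ∧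
      |-omega d Q y D.etaU (σbar i) - ratio Q y D.etaU m * D.etaL| ≤
        ε * (1 - ε) / (1 - 3 / 2 * ε) * (|ratio Q y D.etaU m| * D.etaL) := by
  have hne : ∀ i j : Fin Nu, k ≤ (i : ℕ) + 1 → i ≠ j → d i ≠ d j := by
    intro i j hi hij h
    have := hgap i j hi hij
    rw [h, sub_self, abs_zero] at this
    linarith
  have hσd := D.sigma_ne hVbar hd hk hk' hη hne i hi hl
  have hσle := D.sigma_le hVbar hd hk hk' i hi
  have hσ0 : 0 ≤ σbar i := hVbar.nonneg D.avgAdj_quad_nonneg i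
  have hN : (0 : ℝ) < Fintype.card Xl := by exact_mod_cast Fintype.card_pos
  -- `d m` is the nearest pole above `σbar i`. It is at most `d_k`, which is itself such a pole, so
  -- simplicity of `d_k` gives `m` index at least `k`.
  obtain ⟨m, hm, hmin⟩ := Finset.exists_min_image (Finset.univ.filter fun j => σbar i < d j) d
    ⟨⟨k - 1, hk'⟩, by simpa using lt_of_le_of_ne hσle (hσd _)⟩
  have hm' : σbar i < d m := by simpa using hm
  have hmk : k ≤ (m : ℕ) + 1 := by
    by_contra! h
    have h1 := hmin ⟨k - 1, hk'⟩ (by simpa using lt_of_le_of_ne hσle (hσd _))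
    have h2 : d ⟨k - 1, hk'⟩ ≤ d m := hd.2.1 (Fin.le_def.2 (by simp; omega))
    refine hne ⟨k - 1, hk'⟩ m (by simp; omega) ?_ (le_antisymm h2 h1)
    intro h
    have := congrArg Fin.val h
    simp at this
    omega
  refine ⟨m, hmk, ?_⟩
  have hr := hR m hmk
  rw [omega_eq, neg_neg, hε]
  refine secular_estimate (e := coord Q D.etaU) hL hgap0 (δ := σbar i / (Fintype.card Xl : ℝ))
    (by positivity) ?_ hm' ?_ ?_ (D.secular hVbar hd i hl hσd y).1 ?_ ?_ ?_ ?_ (hε ▸ hε2)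
  · rw [div_le_iff₀ hN]
    refine hσle.trans_eq ?_
    field_simp
  · intro j hj
    rw [abs_sub_comm]
    exact hgap m j hmk hj.symm
  · intro j hj
    refine lt_of_le_of_ne ?_ (hσd j).symm
    by_contra! h
    exact absurd (hmin j (by simpa using h)) (not_le.2 hj)
  · exact abs_pos.1 (hR0.trans_le hr)
  · rw [ratio, div_mul_cancel₀ _ (hη m hmk)]
  · rw [norm2_coord hd.mul_transpose]
    apply le_of_eq
    field_simp
  · rw [norm2_coord hd.mul_transpose, norm2_coord hd.mul_transpose]
    have h1 : norm2 y * norm2 D.etaU =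
        norm2 y * norm2 D.etaU / (D.etaL * gap * R) * D.etaL * gap * R := by
      field_simp
    have h2 : 0 ≤ norm2 y * norm2 D.etaU / (D.etaL * gap * R) * D.etaL * gap := by
      have := norm2_nonneg y
      have := norm2_nonneg D.etaU
      positivity
    conv_lhs => rw [h1]
    exact mul_le_mul_of_nonneg_left hr h2

end Coverage

/-! ### The lower bound on the coverage. -/

section Coverage

variable {Xl Xu Yl : Type*} [Fintype Xl] [Fintype Xu] [Fintype Yl]
  [DecidableEq Xl] [DecidableEq Xu] [Nonempty Xl] (D : Data Xl Xu Yl)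
  {k N : ℕ} {σbar : Fin N → ℝ} {Vbar : Matrix (Xl ⊕ Xu) (Fin N) ℝ}
  {Nu : ℕ} {d : Fin Nu → ℝ} {Q : Matrix Xu (Fin Nu) ℝ}

/-- The coverage as a weighted cosine, if `s` is a sign and `(U^♭)ᵀ y = l^♭ ω` entrywise. -/
theorem sign_mul_cosine_ge {ι : Type*} [Fintype ι] {u l ω : ι → ℝ} {s a b : ℝ}
    (hs : s = 1 ∨ s = -1) (hu : ∀ i, u i = l i * ω i) (hl : l ≠ 0) (ha : 0 < a)
    (hab : ∀ i, l i ≠ 0 → a ≤ s * ω i ∧ s * ω i ≤ b) :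
    2 * √(a * b) / (a + b) ≤ s * cosine u l := by
  obtain ⟨i₀, hi₀⟩ := Function.ne_iff.1 hl
  rw [Pi.zero_apply] at hi₀
  have hb : 0 < b := ha.trans_le ((hab i₀ hi₀).1.trans (hab i₀ hi₀).2)
  have hs2 : s ^ 2 = 1 := by rcases hs with rfl | rfl <;> norm_num
  have key := two_sqrt_mul_le_of_mem_Icc (p := fun i => l i ^ 2) (z := fun i => s * ω i)
    (fun i => sq_nonneg _) ha.le hb.le fun i hi => hab i fun h => hi (by simp [h])
  have e1 : ∑ i, l i ^ 2 * (s * ω i) ^ 2 = u ⬝ᵥ u := by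
    rw [dotProduct]
    refine Finset.sum_congr rfl fun i _ => ?_
    rw [hu, mul_pow s, hs2]
    ring
  have e2 : ∑ i, l i ^ 2 = l ⬝ᵥ l := by
    rw [dotProduct]
    exact Finset.sum_congr rfl fun i _ => sq _
  have e3 : ∑ i, l i ^ 2 * (s * ω i) = s * (u ⬝ᵥ l) := by
    rw [dotProduct, Finset.mul_sum]
    refine Finset.sum_congr rfl fun i _ => ?_
    rw [hu]
    ring
  rw [e1, e2, e3] at key
  have hu0 : u ≠ 0 := by
    intro h
    have h1 := hu i₀
    rw [h, Pi.zero_apply, eq_comm, mul_eq_zero, or_iff_right hi₀] at h1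
    have h2 := (hab i₀ hi₀).1
    rw [h1, mul_zero] at h2
    linarith
  have hpos : 0 < norm2 u * norm2 l := mul_pos (norm2_pos hu0) (norm2_pos hl)
  rw [cosine, ← mul_div_assoc, div_le_div_iff₀ (by linarith) hpos]
  exact key.trans_eq (mul_comm _ _)

/-- The lower bound on the coverage. -/
theorem Data.coverage_bound (hkN : k < N) (hVbar : IsSpectral D.avgAdj σbar Vbar)
    (hd : IsSpectral D.Auu d Q)
    (hk : 0 < k) (hk' : k - 1 < Nu) {y : Xu → ℝ} {s gap : ℝ} (hs : s = 1 ∨ s = -1) (hgap0 : 0 < gap)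
    (hη : ∀ j : Fin Nu, k ≤ (j : ℕ) + 1 → coord Q D.etaU j ≠ 0)
    (hgap : ∀ i j : Fin Nu, k ≤ (i : ℕ) + 1 → i ≠ j → gap ≤ |d i - d j|)
    (hω : ∀ i : {i : Fin N // k ≤ (i : ℕ)}, lflat k Vbar i ≠ 0 →
      0 < s * omega d Q y D.etaU (σbar i)) :
    (1 - 2 * (d ⟨k - 1, hk'⟩ / ((Fintype.card Xl : ℝ) * D.etaL)
          + norm2 D.etaU ^ 2 / (D.etaL * gap)
          + norm2 y * norm2 D.etaU /
              (D.etaL * gap *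
                ⨅ i : {i : Fin Nu // k ≤ (i : ℕ) + 1}, |ratio Q y D.etaU i|))) *
        (⨅ p : {i : Fin Nu // k ≤ (i : ℕ) + 1} × {i : Fin Nu // k ≤ (i : ℕ) + 1},
          2 * √(ratio Q y D.etaU p.1 * ratio Q y D.etaU p.2) /
            |ratio Q y D.etaU p.1 + ratio Q y D.etaU p.2|)
      ≤ s * coverage k Vbar y := by
  set r : {i : Fin Nu // k ≤ (i : ℕ) + 1} → ℝ := fun i => ratio Q y D.etaU i with hr
  have hne : ∀ i j : Fin Nu, k ≤ (i : ℕ) + 1 → i ≠ j → d i ≠ d j := by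
    intro i j hi hij h
    have := hgap i j hi hij
    rw [h, sub_self, abs_zero] at this
    linarith
  have hL : 0 < D.etaL := by
    refine D.etaL_pos (u := fun x => Q x ⟨k - 1, hk'⟩) ?_
    exact hη ⟨k - 1, hk'⟩ (by simp; omega)
  have hd0 : ∀ j, 0 ≤ d j := hd.nonneg D.Auu_quad_nonneg
  have hN : (0 : ℝ) < Fintype.card Xl := by exact_mod_cast Fintype.card_pos
  have hl0 : lflat k Vbar ≠ 0 := lflat_ne_zero hVbar hkN (by rw [hd.1]; omega)
    fun i hi hl => D.unlabeled_eq_zero hVbar hd hk hk' hη hne i hi hl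
  have hU : ∀ i, ((Uflat k Vbar)ᵀ *ᵥ y) i = lflat k Vbar i * omega d Q y D.etaU (σbar i) := by
    intro i
    rw [Uflat_mulVec_apply, lflat_apply]
    by_cases hl : ∑ b, Vbar (Sum.inl b) i.1 = 0
    · rw [hl, zero_mul]
      refine Finset.sum_eq_zero fun x _ => ?_
      rw [D.unlabeled_eq_zero hVbar hd hk hk' hη hne i i.2 hl, zero_mul]
    · exact (D.secular hVbar hd i hl (D.sigma_ne hVbar hd hk hk' hη hne i i.2 hl) y).2
  -- This settles the cases in which the left side is not positive: `ε ≥ 1/2`, or a vanishing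
  -- minimum.
  have hcov0 : 0 ≤ s * coverage k Vbar y := by
    rw [coverage, cosine, ← mul_div_assoc]
    refine div_nonneg ?_ (mul_nonneg (norm2_nonneg _) (norm2_nonneg _))
    rw [dotProduct, Finset.mul_sum]
    refine Finset.sum_nonneg fun i _ => ?_
    rw [hU]
    by_cases hl : lflat k Vbar i = 0
    · simp [hl]
    · linarith [mul_nonneg (hω i hl).le (sq_nonneg (lflat k Vbar i))]
  have hne' : Nonempty {i : Fin Nu // k ≤ (i : ℕ) + 1} :=
    ⟨⟨⟨k - 1, hk'⟩, by simp; omega⟩⟩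
  set R := ⨅ i : {i : Fin Nu // k ≤ (i : ℕ) + 1}, |r i| with hRdef
  set Φ := ⨅ p : {i : Fin Nu // k ≤ (i : ℕ) + 1} × {i : Fin Nu // k ≤ (i : ℕ) + 1},
          2 * √(r p.1 * r p.2) / |r p.1 + r p.2| with hΦ
  have hΦ0 : 0 ≤ Φ := Real.iInf_nonneg fun p => by positivity
  have hΦle : ∀ i j, Φ ≤ 2 * √(r i * r j) / |r i + r j| := fun i j =>
    ciInf_le (f := fun p : {i : Fin Nu // k ≤ (i : ℕ) + 1} × {i : Fin Nu // k ≤ (i : ℕ) + 1} =>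
      2 * √(r p.1 * r p.2) / |r p.1 + r p.2|) (Set.finite_range _).bddBelow (i, j)
  have hR0 : 0 ≤ R := Real.iInf_nonneg fun i => abs_nonneg _
  have hRle : ∀ i, R ≤ |r i| := fun i => ciInf_le (Set.finite_range fun i => |r i|).bddBelow i
  set ε := d ⟨k - 1, hk'⟩ / ((Fintype.card Xl : ℝ) * D.etaL) +
    norm2 D.etaU ^ 2 / (D.etaL * gap) + norm2 y * norm2 D.etaU / (D.etaL * gap * R) with hε
  have hε0 : 0 ≤ ε := by
    have := norm2_nonneg y
    have := norm2_nonneg D.etaU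
    have := hd0 ⟨k - 1, hk'⟩
    positivity
  rcases le_or_gt (1 / 2) ε with hε2 | hε2
  · exact (mul_nonpos_of_nonpos_of_nonneg (by linarith) hΦ0).trans hcov0
  -- If this fails, some square root is `0` and so is the minimum. The case `i = j` covers vanishing
  -- ratios, where `R = 0` and the last quotient in `ε` is read as `0`.
  by_cases hsame : ∀ i j, 0 < r i * r j
  swap
  · push Not at hsame
    obtain ⟨i, j, hij⟩ := hsame
    have h1 := hΦle i j
    rw [Real.sqrt_eq_zero_of_nonpos hij, mul_zero, zero_div] at h1
    rw [le_antisymm h1 hΦ0, mul_zero]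
    exact hcov0
  obtain ⟨i₁, hi₁⟩ := Finite.exists_min fun i => |r i|
  obtain ⟨i₂, hi₂⟩ := Finite.exists_max fun i => |r i|
  have hRi₁ : R = |r i₁| := le_antisymm (hRle i₁) (le_ciInf hi₁)
  have hRpos : 0 < R := by
    rw [hRi₁, abs_pos]
    intro h
    have := hsame i₁ i₁
    rw [h, mul_zero] at this
    exact lt_irrefl _ this
  obtain ⟨hγ1, hγ0, hnum⟩ := one_sub_two_mul_le_sqrt hε0 hε2 rfl (hRi₁ ▸ hRpos) (hi₁ i₂)
  set γ := ε * (1 - ε) / (1 - 3 / 2 * ε) with hγ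
  have hφ : 2 * √(r i₁ * r i₂) / |r i₁ + r i₂| = 2 * √(|r i₁| * |r i₂|) / (|r i₁| + |r i₂|) := by
    rw [← abs_mul, abs_of_pos (hsame i₁ i₂)]
    congr 1
    rcases pos_and_pos_or_neg_and_neg_of_mul_pos (hsame i₁ i₂) with ⟨h1, h2⟩ | ⟨h1, h2⟩
    · rw [abs_of_pos h1, abs_of_pos h2, abs_of_pos (add_pos h1 h2)]
    · rw [abs_of_neg h1, abs_of_neg h2, abs_of_neg (add_neg h1 h2)]
      ring
  -- Each `s * ω_i` is within relative error `γ` of some `|r m| η_l`, so it lies between these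
  -- bounds built from the extreme ratios.
  have hmain := sign_mul_cosine_ge (a := (1 - γ) * |r i₁| * D.etaL)
    (b := (1 + γ) * |r i₂| * D.etaL) hs hU hl0 (by rw [← hRi₁]; positivity) ?_
  · refine le_trans ?_ hmain
    refine (mul_le_mul_of_nonneg_left (hΦle i₁ i₂) (by linarith)).trans ?_
    rw [hφ]
    refine hnum.trans_eq ?_
    have e1 : (1 - γ) * |r i₁| * D.etaL * ((1 + γ) * |r i₂| * D.etaL) =
        D.etaL ^ 2 * ((1 - γ) * |r i₁| * ((1 + γ) * |r i₂|)) := by ring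
    rw [e1, Real.sqrt_mul (sq_nonneg _), Real.sqrt_sq hL.le, ← add_mul, mul_comm D.etaL,
      ← mul_assoc 2, mul_div_mul_right _ _ hL.ne']
  · intro i hi
    have hli : ∑ b, Vbar (Sum.inl b) i.1 ≠ 0 := by rwa [lflat_apply] at hi
    obtain ⟨m, hm, hest⟩ := D.omega_estimate hVbar hd hk hk' hgap0 hη hgap hRpos
      (fun j hj => hRle ⟨j, hj⟩) hε hε2 hL i.1 i.2 hli
    have hpos := hω i hi
    have habs : s * omega d Q y D.etaU (σbar i) = |-omega d Q y D.etaU (σbar i)| := by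
      rw [abs_neg, ← abs_of_pos hpos, abs_mul]
      rcases hs with h | h <;> simp [h]
    have h1 := hi₁ ⟨m, hm⟩
    have h2 := hi₂ ⟨m, hm⟩
    have h3 := (abs_le.1 ((abs_abs_sub_abs_le_abs_sub _ _).trans hest))
    rw [abs_mul, abs_of_pos hL] at h3
    simp only [hr] at h1 h2 ⊢
    rw [habs]
    constructor
    · have : (1 - γ) * |ratio Q y D.etaU i₁| * D.etaL ≤ (1 - γ) * |ratio Q y D.etaU m| * D.etaL :=
        mul_le_mul_of_nonneg_right (mul_le_mul_of_nonneg_left h1 hγ1.le) hL.le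
      linarith [h3.1]
    · have : (1 + γ) * |ratio Q y D.etaU m| * D.etaL ≤ (1 + γ) * |ratio Q y D.etaU i₂| * D.etaL :=
        mul_le_mul_of_nonneg_right (mul_le_mul_of_nonneg_left h2 (by linarith)) hL.le
      linarith [h3.2]

end Coverage

end NCD

theorem mainTheorem2 {Xl Xu Yl : Type*} [Fintype Xl] [Fintype Xu] [Fintype Yl]
    [DecidableEq Xl] [DecidableEq Xu] [Nonempty Xl] [Nonempty Xu]
    (D : NCD.Data Xl Xu Yl) (hdeg : ∀ x, 0 < D.deg x)
    (k N : ℕ) (hk : 0 < k) (hkN : k < N)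
    -- spectral decompositions of the normalized adjacency matrix and of its approximation
    (σ : Fin N → ℝ) (V : Matrix (Xl ⊕ Xu) (Fin N) ℝ) (hV : NCD.IsSpectral D.normAdj σ V)
    (σbar : Fin N → ℝ) (Vbar : Matrix (Xl ⊕ Xu) (Fin N) ℝ)
    (hVbar : NCD.IsSpectral D.avgAdj σbar Vbar) :
    -- the bound on the linear probing error
    (∀ (c : ℕ) (argmax : (Fin c → ℝ) → Fin c) (label : Xu → Fin c)
        (f : Xl ⊕ Xu → Fin k → ℝ),
      (∀ (v : Fin c → ℝ) (i : Fin c), v i ≤ v (argmax v)) →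
      -- the novel classes are balanced
      (∀ i, (Finset.univ.filter fun x => label x = i).card * c = Fintype.card Xu) →
      -- the learned representation minimizes the loss
      (∀ g : Xl ⊕ Xu → Fin k → ℝ, D.nscl f ≤ D.nscl g) →
      NCD.specNorm (D.normAdj - D.avgAdj)
        < 1 / 2 * (σ ⟨k - 1, by omega⟩ - σ ⟨k, hkN⟩) →
      (NCD.probingError argmax label f : ℝ) ≤
        2 * (Fintype.card Xu : ℝ) / (c : ℝ) *
          (∑ i : Fin c, NCD.ignorance k Vbar (NCD.labelVec label i) *
              (1 - NCD.coverage k Vbar (NCD.labelVec label i) ^ 2)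
            + (2 * ∑ i : Fin c, (1 + (Fintype.card Xl : ℝ) *
                  NCD.coverage k Vbar (NCD.labelVec label i) ^ 2 *
                  NCD.ignorance k Vbar (NCD.labelVec label i) ^ 2
                    / NCD.norm2 (NCD.lflat k Vbar) ^ 2)) *
              (NCD.specNorm (D.normAdj - D.avgAdj)
                / (σ ⟨k - 1, by omega⟩ - σ ⟨k, hkN⟩)))) ∧
    -- the lower bound on the coverage
    (∀ (Nu : ℕ) (hNu : k ≤ Nu) (d : Fin Nu → ℝ) (Q : Matrix Xu (Fin Nu) ℝ),
      NCD.IsSpectral D.Auu d Q →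
      ∀ (y : Xu → ℝ) (s gap : ℝ), (s = 1 ∨ s = -1) → 0 < gap →
      (∀ i : Fin Nu, k ≤ (i : ℕ) + 1 → NCD.coord Q D.etaU i ≠ 0) →
      (∀ i j : Fin Nu, k ≤ (i : ℕ) + 1 → i ≠ j → gap ≤ |d i - d j|) →
      (∀ i : {i : Fin N // k ≤ (i : ℕ)}, NCD.lflat k Vbar i ≠ 0 →
        0 < s * NCD.omega d Q y D.etaU (σbar i)) →
      (1 - 2 * (d ⟨k - 1, by omega⟩ / ((Fintype.card Xl : ℝ) * D.etaL)
            + NCD.norm2 D.etaU ^ 2 / (D.etaL * gap)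
            + NCD.norm2 y * NCD.norm2 D.etaU /
                (D.etaL * gap *
                  ⨅ i : {i : Fin Nu // k ≤ (i : ℕ) + 1}, |NCD.ratio Q y D.etaU i|))) *
          (⨅ p : {i : Fin Nu // k ≤ (i : ℕ) + 1} × {i : Fin Nu // k ≤ (i : ℕ) + 1},
            2 * √(NCD.ratio Q y D.etaU p.1 * NCD.ratio Q y D.etaU p.2) /
              |NCD.ratio Q y D.etaU p.1 + NCD.ratio Q y D.etaU p.2|)
        ≤ s * NCD.coverage k Vbar y) := by
  refine ⟨fun c argmax label f hargmax hbal hf hgap =>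
      D.probingError_bound hdeg hk hkN _ hV hVbar hargmax hbal hf hgap, ?_⟩
  intro Nu hNu d Q hd y s gap hs hgap0 hη hgap hω
  exact D.coverage_bound hkN hVbar hd hk _ hs hgap0 hη hgap hω
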